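/- All vector spaces are over $\mathbb Q$ and graded Lie algebras are $\mathbb Z$-graded with Koszul signs. Let $\mathbb L(a,b,x)$ be the free graded Lie algebra on generators $a,b$ of degree $-1$ and $x$ of degree $0$, and let $\widehat{\mathbb L}(a,b,x)=\varprojlim_n \mathbb L(a,b,x)/\mathbb L(a,b,x)^n$ be its completion, where $L^1=L$, $L^n=[L,L^{n-1}]$ and the limit is taken in each degree. A differential is a linear derivation of degree $-1$ and square zero. Power series in $\mathrm{ad}_x$ are evaluated as convergent series in the completion; $\frac{t}{e^t-1}=\sum_{n\ge 0}\frac{B_n}{n!}t^n$ with $B_n$ the Bernoulli numbers ($B_1=-\frac12$). There is a unique differential $\partial$ on $\widehat{\mathbb L}(a,b,x)$ such that $a$ and $b$ are Maurer–Cartan elements, i.e. $\partial a=-\frac12[a,a]$ and $\partial b=-\frac12[b,b]$, and $$\partial x=\mathrm{ad}_x b+\frac{\mathrm{ad}_x}{e^{\mathrm{ad}_x}-1}(b-a);$$ the differential graded Lie algebra $\mathfrak L=(\widehat{\mathbb L}(a,b,x),\partial)$ is the Lawrence–Sullivan interval. There is also a unique differential $\partial'$ on $\widehat{\mathbb L}(a,b,x)$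 such that $$\partial' a=-\tfrac12[a,a],\qquad \partial' b=-\tfrac12[b,b],\qquad \partial' x=\frac{-\mathrm{ad}_x}{e^{-\mathrm{ad}_x}-1}(b).$$ The differential graded Lie algebras $(\widehat{\mathbb L}(a,b,x),\partial')$ and $\mathfrak L$ are isomorphic: there is a unique isomorphism of differential graded Lie algebras $$\varphi\colon(\widehat{\mathbb L}(a,b,x),\partial')\longrightarrow\mathfrak L$$ with $\varphi(a)=a$, $\varphi(b)=a-e^{\mathrm{ad}_x}(b)$ and $\varphi(x)=-x$. -/

import Mathlib

namespace LSInterval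

noncomputable section

/-! ## Graded Lie algebras over the rationals -/

/-- A `ℤ`-graded Lie algebra over `ℚ`: a graded vector space `L = ⨁ p, comp p` with a bilinear
bracket `br` of degree zero satisfying graded antisymmetry and the graded Jacobi identity, with
Koszul signs (so it is not in general a Lie algebra in the ungraded sense). -/
class SignedGLA (L : Type*) [AddCommGroup L] [Module ℚ L] where
  /-- the homogeneous component of degree `p` -/
  comp : ℤ → Submodule ℚ L
  isInternal : DirectSum.IsInternal comp
  /-- the Lie bracket -/
  br : L →ₗ[ℚ] L →ₗ[ℚ] L
  br_mem : ∀ {p q : ℤ} {x y : L}, x ∈ comp p → y ∈ comp q → br x y ∈ comp (p + q)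
  br_antisymm : ∀ {p q : ℤ} {x y : L}, x ∈ comp p → y ∈ comp q →
    br x y = -((-1 : ℚ) ^ (p * q) • br y x)
  br_jacobi : ∀ {p q r : ℤ} {x y z : L}, x ∈ comp p → y ∈ comp q → z ∈ comp r →
    (-1 : ℚ) ^ (p * r) • br x (br y z) + (-1 : ℚ) ^ (q * p) • br y (br z x)
      + (-1 : ℚ) ^ (r * q) • br z (br x y) = 0

open LSInterval.SignedGLA

/-- A differential on a graded Lie algebra: a linear derivation of degree `-1` and square zero.
A graded Lie algebra together with a differential is a differential graded Lie algebra (DGL). -/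
structure Differential (L : Type*) [AddCommGroup L] [Module ℚ L] [SignedGLA L] where
  toFun : L →ₗ[ℚ] L
  map_mem : ∀ {p : ℤ} {x : L}, x ∈ comp p → toFun x ∈ comp (p - 1)
  leibniz : ∀ {p : ℤ} {x : L} (y : L), x ∈ comp p →
    toFun (br x y) = br (toFun x) y + (-1 : ℚ) ^ p • br x (toFun y)
  square_zero : ∀ x : L, toFun (toFun x) = 0

/-- An isomorphism of DGLs `(L, d) ≅ (L', d')`: a degree-preserving linear bijection compatible
with the brackets and with the differentials. -/
structure DGLIso {L L' : Type*} [AddCommGroup L] [Module ℚ L] [SignedGLA L]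
    [AddCommGroup L'] [Module ℚ L'] [SignedGLA L']
    (d : Differential L) (d' : Differential L') where
  toEquiv : L ≃ₗ[ℚ] L'
  map_mem : ∀ {p : ℤ} {x : L}, x ∈ comp p → toEquiv x ∈ comp p
  map_br : ∀ x y : L, toEquiv (br x y) = br (toEquiv x) (toEquiv y)
  map_d : ∀ x : L, toEquiv (d.toFun x) = d'.toFun (toEquiv x)

/-- `z` is a Maurer-Cartan element of `(L, d)`. -/
def IsMaurerCartan {L : Type*} [AddCommGroup L] [Module ℚ L] [SignedGLA L]
    (d : Differential L) (z : L) : Prop :=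
  z ∈ comp (L := L) (-1) ∧ d.toFun z + (1 / 2 : ℚ) • br z z = 0

/-! ## Gradings and quotients -/

theorem iSupIndep_map_mkQ {M : Type*} [AddCommGroup M] [Module ℚ M] {C : ℤ → Submodule ℚ M}
    (hC : iSupIndep C) {W : Submodule ℚ M} (hW : W ≤ ⨆ p, W ⊓ C p) :
    iSupIndep fun p => (C p).map W.mkQ := by
  intro i
  rw [Submodule.disjoint_def]
  rintro _ ⟨c, hc, rfl⟩ h2
  simp only [← Submodule.map_iSup] at h2
  obtain ⟨e, he, hce⟩ := h2
  have hm : c - e ∈ W := by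
    rw [← Submodule.Quotient.eq]
    exact hce.symm
  have hm2 : c - e ∈ (W ⊓ C i) ⊔ ⨆ j, ⨆ (_ : j ≠ i), W ⊓ C j := by
    refine (hW.trans (iSup_le fun j => ?_)) hm
    by_cases hj : j = i
    · subst hj; exact le_sup_left
    · exact le_sup_of_le_right (le_iSup₂_of_le j hj le_rfl)
  obtain ⟨w, hw, w', hw', hww⟩ := Submodule.mem_sup.1 hm2
  have hw'' : w' ∈ ⨆ j, ⨆ (_ : j ≠ i), C j :=
    (iSup₂_mono (fun j _ => inf_le_right) : (⨆ j, ⨆ (_ : j ≠ i), W ⊓ C j) ≤ _) hw'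
  have h0 : c - w = 0 := by
    refine Submodule.disjoint_def.1 (hC i) _ (sub_mem hc hw.2) ?_
    have : c - w = e + w' := by
      rw [sub_eq_iff_eq_add, add_assoc, add_comm w' w, hww]; abel
    rw [this]
    exact add_mem he hw''
  rw [sub_eq_zero.1 h0]
  simpa using hw.1

theorem isInternal_map_mkQ {M : Type*} [AddCommGroup M] [Module ℚ M] {C : ℤ → Submodule ℚ M}
    (hC : DirectSum.IsInternal C) {W : Submodule ℚ M} (hW : W ≤ ⨆ p, W ⊓ C p) :
    DirectSum.IsInternal fun p => (C p).map W.mkQ := by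
  rw [DirectSum.isInternal_submodule_iff_iSupIndep_and_iSup_eq_top] at hC ⊢
  refine ⟨iSupIndep_map_mkQ hC.1 hW, ?_⟩
  rw [← Submodule.map_iSup, hC.2, Submodule.map_top, Submodule.range_mkQ]

/-- A bilinear operation descends to the quotient by a two-sided ideal. -/
def quotBr {M : Type*} [AddCommGroup M] [Module ℚ M] (b : M →ₗ[ℚ] M →ₗ[ℚ] M)
    (W : Submodule ℚ M) (hr : ∀ x, ∀ y ∈ W, b x y ∈ W) (hl : ∀ x ∈ W, ∀ y, b x y ∈ W) :
    (M ⧸ W) →ₗ[ℚ] (M ⧸ W) →ₗ[ℚ] (M ⧸ W) :=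
  W.liftQ
    { toFun := fun x => W.liftQ (W.mkQ ∘ₗ b x) fun y hy => by simpa using hr x y hy
      map_add' := fun x x' => by
        refine Submodule.linearMap_qext _ (LinearMap.ext fun y => ?_)
        simp
      map_smul' := fun c x => by
        refine Submodule.linearMap_qext _ (LinearMap.ext fun y => ?_)
        simp }
    fun x hx => by
      refine Submodule.linearMap_qext _ (LinearMap.ext fun y => ?_)
      simpa using hl x hx y

@[simp]
theorem quotBr_mk {M : Type*} [AddCommGroup M] [Module ℚ M] (b : M →ₗ[ℚ] M →ₗ[ℚ] M)
    (W : Submodule ℚ M) (hr : ∀ x, ∀ y ∈ W, b x y ∈ W) (hl : ∀ x ∈ W, ∀ y, b x y ∈ W)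
    (x y : M) : quotBr b W hr hl (W.mkQ x) (W.mkQ y) = W.mkQ (b x y) := rfl

/-! ## The free graded Lie algebra on a graded set -/

section Free

variable {X : Type*}

/-- The free non-associative `ℚ`-algebra on `X`: formal linear combinations of bracketed words. -/
abbrev Words (X : Type*) : Type _ := FreeNonUnitalNonAssocAlgebra ℚ X

/-- A bracketed word, as an element of the free non-associative algebra. -/
abbrev word (w : FreeMagma X) : Words X := MonoidAlgebra.single w 1

/-- The degree of a bracketed word: the sum of the degrees of its letters. -/
def wordDeg (deg : X → ℤ) : FreeMagma X → ℤ
  | FreeMagma.of x => deg x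
  | FreeMagma.mul u v => wordDeg deg u + wordDeg deg v

theorem wordDeg_mul (deg : X → ℤ) (u v : FreeMagma X) :
    wordDeg deg (u * v) = wordDeg deg u + wordDeg deg v := rfl

/-- The linear combinations of words of degree `p`. -/
def wordComp (deg : X → ℤ) (p : ℤ) : Submodule ℚ (Words X) :=
  Submodule.span ℚ {f | ∃ w, wordDeg deg w = p ∧ f = word w}

/-- The multiplication of the free non-associative algebra. -/
def wordMul : Words X →ₗ[ℚ] Words X →ₗ[ℚ] Words X := LinearMap.mul ℚ (Words X)

/-- The two-sided ideal generated by graded antisymmetry and the graded Jacobi identity. -/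
def relIdeal (deg : X → ℤ) : Submodule ℚ (Words X) :=
  sInf {I | (∀ u v : FreeMagma X,
        word u * word v + (-1 : ℚ) ^ (wordDeg deg u * wordDeg deg v) • (word v * word u) ∈ I) ∧
      (∀ u v w : FreeMagma X,
        (-1 : ℚ) ^ (wordDeg deg u * wordDeg deg w) • (word u * (word v * word w))
        + (-1 : ℚ) ^ (wordDeg deg v * wordDeg deg u) • (word v * (word w * word u))
        + (-1 : ℚ) ^ (wordDeg deg w * wordDeg deg v) • (word w * (word u * word v)) ∈ I) ∧
      (∀ f, ∀ g ∈ I, f * g ∈ I) ∧ (∀ f ∈ I, ∀ g, f * g ∈ I)}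

/-- The free graded Lie algebra over `ℚ` on a set `X` of homogeneous generators, `x : X` having
degree `deg x`. -/
def FreeGLA (deg : X → ℤ) : Type _ := Words X ⧸ relIdeal deg

instance (deg : X → ℤ) : AddCommGroup (FreeGLA deg) :=
  inferInstanceAs (AddCommGroup (Words X ⧸ relIdeal deg))

instance (deg : X → ℤ) : Module ℚ (FreeGLA deg) :=
  inferInstanceAs (Module ℚ (Words X ⧸ relIdeal deg))

theorem word_mem (deg : X → ℤ) (w : FreeMagma X) : word w ∈ wordComp deg (wordDeg deg w) :=
  Submodule.subset_span ⟨w, rfl, rfl⟩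

theorem word_mul_word (u v : FreeMagma X) : word u * word v = word (u * v) := by
  simp [word, MonoidAlgebra.single_mul_single]

theorem wordComp_mul {deg : X → ℤ} {p q : ℤ} {f g : Words X} (hf : f ∈ wordComp deg p)
    (hg : g ∈ wordComp deg q) : f * g ∈ wordComp deg (p + q) := by
  induction hf using Submodule.span_induction with
  | mem f hf =>
    obtain ⟨u, rfl, rfl⟩ := hf
    induction hg using Submodule.span_induction with
    | mem g hg =>
      obtain ⟨v, rfl, rfl⟩ := hg
      rw [word_mul_word]
      exact word_mem deg (u * v)
    | zero => simp
    | add g g' _ _ h h' => rw [mul_add]; exact add_mem h h'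
    | smul c g _ h => rw [mul_smul_comm]; exact Submodule.smul_mem _ c h
  | zero => simp
  | add f f' _ _ h h' => rw [add_mul]; exact add_mem h h'
  | smul c f _ h => rw [smul_mul_assoc]; exact Submodule.smul_mem _ c h

theorem wordComp_isInternal (deg : X → ℤ) : DirectSum.IsInternal (wordComp deg) := by
  rw [DirectSum.isInternal_submodule_iff_iSupIndep_and_iSup_eq_top]
  constructor
  · let S : Set (FreeMagma X) → Submodule ℚ (Words X) := fun A =>
      { carrier := {f | ∀ w ∈ A, f.coeff w = 0}
        add_mem' := fun {f g} hf hg w hw => by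
          have h1 := hf w hw
          have h2 := hg w hw
          change f.coeff w + g.coeff w = 0
          rw [h1, h2, add_zero]
        zero_mem' := fun w _ => rfl
        smul_mem' := fun c f hf w hw => by
          have h1 := hf w hw
          change c • f.coeff w = 0
          rw [h1, smul_zero] }
    have key : ∀ p, ∀ A : Set (FreeMagma X), (∀ w ∈ A, wordDeg deg w ≠ p) →
        wordComp deg p ≤ S A := by
      intro p A hA
      refine Submodule.span_le.2 ?_
      rintro _ ⟨u, rfl, rfl⟩ w hw
      exact Finsupp.single_eq_of_ne (fun h => hA w hw (by rw [h]))
    intro p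
    rw [Submodule.disjoint_def]
    intro f hf hf'
    have h1 := key p {w | wordDeg deg w ≠ p} (fun w hw => hw) hf
    have h2 : (⨆ q, ⨆ (_ : q ≠ p), wordComp deg q) ≤ S {w | wordDeg deg w = p} :=
      iSup₂_le fun q hq => key q _ fun w hw h => hq (by rw [← h]; exact hw)
    refine MonoidAlgebra.ext (Finsupp.ext fun w => ?_)
    by_cases h : wordDeg deg w = p
    · exact h2 hf' w h
    · exact h1 w h
  · rw [eq_top_iff]
    intro f _
    induction f using MonoidAlgebra.induction_linear with
    | zero => exact zero_mem _
    | add f g hf hg => exact add_mem (hf trivial) (hg trivial)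
    | single w c =>
      have : (MonoidAlgebra.single w c : Words X) = c • word w := by simp [word]
      rw [this]
      exact Submodule.smul_mem _ _ (Submodule.mem_iSup_of_mem _ (word_mem deg w))

theorem wordComp_iSup (deg : X → ℤ) (f : Words X) : f ∈ ⨆ p, wordComp deg p := by
  have h := (DirectSum.isInternal_submodule_iff_iSupIndep_and_iSup_eq_top _).1
    (wordComp_isInternal deg)
  rw [h.2]
  trivial

theorem relIdeal_mul_left (deg : X → ℤ) (f g : Words X) (hg : g ∈ relIdeal deg) :
    f * g ∈ relIdeal deg := by
  rw [relIdeal, Submodule.mem_sInf] at *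
  exact fun I hI => hI.2.2.1 f g (hg I hI)

theorem relIdeal_mul_right (deg : X → ℤ) (f : Words X) (hf : f ∈ relIdeal deg) (g : Words X) :
    f * g ∈ relIdeal deg := by
  rw [relIdeal, Submodule.mem_sInf] at *
  exact fun I hI => hI.2.2.2 f (hf I hI) g

theorem relIdeal_antisymm (deg : X → ℤ) (u v : FreeMagma X) :
    word u * word v + (-1 : ℚ) ^ (wordDeg deg u * wordDeg deg v) • (word v * word u)
      ∈ relIdeal deg := by
  rw [relIdeal, Submodule.mem_sInf]
  exact fun I hI => hI.1 u v

theorem relIdeal_jacobi (deg : X → ℤ) (u v w : FreeMagma X) :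
    (-1 : ℚ) ^ (wordDeg deg u * wordDeg deg w) • (word u * (word v * word w))
      + (-1 : ℚ) ^ (wordDeg deg v * wordDeg deg u) • (word v * (word w * word u))
      + (-1 : ℚ) ^ (wordDeg deg w * wordDeg deg v) • (word w * (word u * word v))
      ∈ relIdeal deg := by
  rw [relIdeal, Submodule.mem_sInf]
  exact fun I hI => hI.2.1 u v w

theorem relIdeal_homogeneous (deg : X → ℤ) :
    relIdeal deg ≤ ⨆ p, relIdeal deg ⊓ wordComp deg p := by
  refine sInf_le ⟨?_, ?_, ?_, ?_⟩
  · intro u v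
    refine Submodule.mem_iSup_of_mem (wordDeg deg u + wordDeg deg v)
      ⟨relIdeal_antisymm deg u v, ?_⟩
    refine add_mem (wordComp_mul (word_mem deg u) (word_mem deg v)) (Submodule.smul_mem _ _ ?_)
    rw [add_comm]
    exact wordComp_mul (word_mem deg v) (word_mem deg u)
  · intro u v w
    refine Submodule.mem_iSup_of_mem (wordDeg deg u + (wordDeg deg v + wordDeg deg w))
      ⟨relIdeal_jacobi deg u v w, ?_⟩
    have hu := word_mem deg u
    have hv := word_mem deg v
    have hw := word_mem deg w
    refine add_mem (add_mem (Submodule.smul_mem _ _ ?_) (Submodule.smul_mem _ _ ?_))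
      (Submodule.smul_mem _ _ ?_)
    · exact wordComp_mul hu (wordComp_mul hv hw)
    · convert wordComp_mul hv (wordComp_mul hw hu) using 1
      ring_nf
    · convert wordComp_mul hw (wordComp_mul hu hv) using 1
      ring_nf
  · intro f g hg
    refine Submodule.iSup_induction _ (motive := fun g => f * g ∈ _) hg ?_ ?_ ?_
    · intro q g hg
      refine Submodule.iSup_induction _ (motive := fun f => f * g ∈ _) (wordComp_iSup deg f) ?_ ?_ ?_
      · intro p f hf
        exact Submodule.mem_iSup_of_mem (p + q)
          ⟨relIdeal_mul_left deg f g hg.1, wordComp_mul hf hg.2⟩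
      · simp
      · intro f f' h h'
        rw [add_mul]; exact add_mem h h'
    · simp
    · intro g g' h h'
      rw [mul_add]; exact add_mem h h'
  · intro f hf g
    refine Submodule.iSup_induction _ (motive := fun f => f * g ∈ _) hf ?_ ?_ ?_
    · intro p f hf
      refine Submodule.iSup_induction _ (motive := fun g => f * g ∈ _) (wordComp_iSup deg g) ?_ ?_ ?_
      · intro q g hg
        exact Submodule.mem_iSup_of_mem (p + q)
          ⟨relIdeal_mul_right deg f hf.1 g, wordComp_mul hf.2 hg⟩
      · simp
      · intro g g' h h'
        rw [mul_add]; exact add_mem h h'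
    · simp
    · intro f f' h h'
      rw [add_mul]; exact add_mem h h'

/-- Multiplication of words satisfies antisymmetry modulo the ideal. -/
theorem words_antisymm {deg : X → ℤ} {p q : ℤ} {f g : Words X} (hf : f ∈ wordComp deg p)
    (hg : g ∈ wordComp deg q) : f * g + (-1 : ℚ) ^ (p * q) • (g * f) ∈ relIdeal deg := by
  induction hf using Submodule.span_induction with
  | mem f hf =>
    obtain ⟨u, rfl, rfl⟩ := hf
    induction hg using Submodule.span_induction with
    | mem g hg =>
      obtain ⟨v, rfl, rfl⟩ := hg
      exact relIdeal_antisymm deg u v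
    | zero => simp
    | add g g' _ _ h h' =>
      convert add_mem h h' using 1
      simp only [mul_add, add_mul, smul_add]; abel
    | smul c g _ h =>
      convert Submodule.smul_mem _ c h using 1
      simp only [mul_smul_comm, smul_mul_assoc, smul_add, smul_comm c]
  | zero => simp
  | add f f' _ _ h h' =>
    convert add_mem h h' using 1
    simp only [mul_add, add_mul, smul_add]; abel
  | smul c f _ h =>
    convert Submodule.smul_mem _ c h using 1
    simp only [mul_smul_comm, smul_mul_assoc, smul_add, smul_comm c]

/-- Multiplication of words satisfies the Jacobi identity modulo the ideal. -/
theorem words_jacobi {deg : X → ℤ} {p q r : ℤ} {f g k : Words X} (hf : f ∈ wordComp deg p)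
    (hg : g ∈ wordComp deg q) (hk : k ∈ wordComp deg r) :
    (-1 : ℚ) ^ (p * r) • (f * (g * k)) + (-1 : ℚ) ^ (q * p) • (g * (k * f))
      + (-1 : ℚ) ^ (r * q) • (k * (f * g)) ∈ relIdeal deg := by
  induction hf using Submodule.span_induction with
  | mem f hf =>
    obtain ⟨u, rfl, rfl⟩ := hf
    induction hg using Submodule.span_induction with
    | mem g hg =>
      obtain ⟨v, rfl, rfl⟩ := hg
      induction hk using Submodule.span_induction with
      | mem k hk =>
        obtain ⟨w, rfl, rfl⟩ := hk
        exact relIdeal_jacobi deg u v w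
      | zero => simp
      | add g g' _ _ h h' =>
        convert add_mem h h' using 1
        simp only [mul_add, add_mul, smul_add]; abel
      | smul c g _ h =>
        convert Submodule.smul_mem _ c h using 1
        simp only [mul_smul_comm, smul_mul_assoc, smul_add, smul_comm c]
    | zero => simp
    | add g g' _ _ h h' =>
      convert add_mem h h' using 1
      simp only [mul_add, add_mul, smul_add]; abel
    | smul c g _ h =>
      convert Submodule.smul_mem _ c h using 1
      simp only [mul_smul_comm, smul_mul_assoc, smul_add, smul_comm c]
  | zero => simp
  | add f f' _ _ h h' =>
    convert add_mem h h' using 1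
    simp only [mul_add, add_mul, smul_add]; abel
  | smul c f _ h =>
    convert Submodule.smul_mem _ c h using 1
    simp only [mul_smul_comm, smul_mul_assoc, smul_add, smul_comm c]

instance FreeGLA.instSignedGLA (deg : X → ℤ) :
    SignedGLA (FreeGLA deg) where
  comp p := (wordComp deg p).map (relIdeal deg).mkQ
  isInternal := isInternal_map_mkQ (wordComp_isInternal deg) (relIdeal_homogeneous deg)
  br := quotBr wordMul (relIdeal deg) (relIdeal_mul_left deg) (relIdeal_mul_right deg)
  br_mem := by
    rintro p q _ _ ⟨f, hf, rfl⟩ ⟨g, hg, rfl⟩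
    exact ⟨f * g, wordComp_mul hf hg, rfl⟩
  br_antisymm := by
    rintro p q _ _ ⟨f, hf, rfl⟩ ⟨g, hg, rfl⟩
    rw [eq_neg_iff_add_eq_zero]
    exact (Submodule.Quotient.mk_eq_zero _).2 (words_antisymm hf hg)
  br_jacobi := by
    rintro p q r _ _ _ ⟨f, hf, rfl⟩ ⟨g, hg, rfl⟩ ⟨k, hk, rfl⟩
    exact (Submodule.Quotient.mk_eq_zero _).2 (words_jacobi hf hg hk)

/-- The generators of the free graded Lie algebra. -/
def FreeGLA.gen (deg : X → ℤ) (x : X) : FreeGLA deg :=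
  (relIdeal deg).mkQ (word (FreeMagma.of x))

end Free

/-! ## The completion of a graded Lie algebra -/

section Completion

variable (L : Type*) [AddCommGroup L] [Module ℚ L] [SignedGLA L]

/-- The lower central series, numbered from zero: `lcs L n` is `L^(n+1)`, where `L^1 = L` and
`L^n = [L, L^(n-1)]` (the linear span of the brackets) for `n ≥ 2`. -/
def lcs : ℕ → Submodule ℚ L
  | 0 => ⊤
  | n + 1 => Submodule.span ℚ {z | ∃ x : L, ∃ y ∈ lcs n, z = br x y}

theorem comp_iSup (x : L) : x ∈ ⨆ p, comp (L := L) p := by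
  have h := (DirectSum.isInternal_submodule_iff_iSupIndep_and_iSup_eq_top _).1
    (isInternal (L := L))
  rw [h.2]
  trivial

theorem br_mem_lcs_succ {n : ℕ} (x y : L) (hy : y ∈ lcs L n) : br x y ∈ lcs L (n + 1) :=
  Submodule.subset_span ⟨x, y, hy, rfl⟩

theorem lcs_succ_le (n : ℕ) : lcs L (n + 1) ≤ lcs L n := by
  induction n with
  | zero => exact le_top
  | succ n ih =>
    refine Submodule.span_le.2 ?_
    rintro _ ⟨x, y, hy, rfl⟩
    exact br_mem_lcs_succ L x y (ih hy)

theorem lcs_homogeneous (n : ℕ) : lcs L n ≤ ⨆ p, lcs L n ⊓ comp p := by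
  induction n with
  | zero =>
    intro x _
    simpa [lcs] using comp_iSup L x
  | succ n ih =>
    refine Submodule.span_le.2 ?_
    rintro _ ⟨x, y, hy, rfl⟩
    refine Submodule.iSup_induction _ (motive := fun y => br x y ∈ _) (ih hy) ?_ ?_ ?_
    · intro q y hy
      refine Submodule.iSup_induction _ (motive := fun x => br x y ∈ _) (comp_iSup L x) ?_ ?_ ?_
      · intro p x hx
        exact Submodule.mem_iSup_of_mem (p + q) ⟨br_mem_lcs_succ L x y hy.1, br_mem hx hy.2⟩
      · simp
      · intro x x' h h'
        rw [map_add, LinearMap.add_apply]; exact add_mem h h'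
    · simp
    · intro y y' h h'
      rw [map_add]; exact add_mem h h'

theorem lcs_br_right (n : ℕ) (x y : L) (hy : y ∈ lcs L n) : br x y ∈ lcs L n :=
  lcs_succ_le L n (br_mem_lcs_succ L x y hy)

theorem lcs_br_left (n : ℕ) (x : L) (hx : x ∈ lcs L n) (y : L) : br x y ∈ lcs L n := by
  refine Submodule.iSup_induction _ (motive := fun x => br x y ∈ _) (lcs_homogeneous L n hx) ?_ ?_ ?_
  · intro p x hx
    refine Submodule.iSup_induction _ (motive := fun y => br x y ∈ _) (comp_iSup L y) ?_ ?_ ?_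
    · intro q y hy
      rw [br_antisymm hx.2 hy]
      exact neg_mem (Submodule.smul_mem _ _ (lcs_br_right L n y x hx.1))
    · simp
    · intro y y' h h'
      rw [map_add]; exact add_mem h h'
  · simp
  · intro x x' h h'
    rw [map_add, LinearMap.add_apply]; exact add_mem h h'

/-- The bracket of the quotient `L / lcs L n`. -/
def brQ (n : ℕ) : (L ⧸ lcs L n) →ₗ[ℚ] (L ⧸ lcs L n) →ₗ[ℚ] (L ⧸ lcs L n) :=
  quotBr br (lcs L n) (lcs_br_right L n) (lcs_br_left L n)

/-- The degree `p` part of `lim L / L^n`: the coherent sequences of classes of elements of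
degree `p`. -/
def limComp (p : ℤ) : Submodule ℚ (∀ n, L ⧸ lcs L n) where
  carrier := {u | (∀ n, u n ∈ (comp p).map (lcs L n).mkQ) ∧
    ∀ n, Submodule.factor (lcs_succ_le L n) (u (n + 1)) = u n}
  add_mem' := fun hu hv => ⟨fun n => add_mem (hu.1 n) (hv.1 n), fun n => by
    simp [hu.2 n, hv.2 n]⟩
  zero_mem' := ⟨fun n => zero_mem _, fun n => by simp⟩
  smul_mem' := fun c u hu => ⟨fun n => Submodule.smul_mem _ c (hu.1 n), fun n => by
    simp [hu.2 n]⟩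

/-- The completion `lim L / L^n` of a graded Lie algebra. The projective limit is the one of graded
vector spaces, so the completion is the sum of the limits taken in each degree. -/
def Completion : Type _ := ↥(⨆ p, limComp L p)

instance : AddCommGroup (Completion L) := (⨆ p, limComp L p).addCommGroup

instance : Module ℚ (Completion L) := (⨆ p, limComp L p).module

/-- The element of the completion given by a coherent family. -/
def Completion.mk (u : ∀ n, L ⧸ lcs L n) (hu : u ∈ ⨆ p, limComp L p) : Completion L := ⟨u, hu⟩

/-- The inclusion of the completion in the product of the quotients. -/
def Completion.incl : Completion L →ₗ[ℚ] (∀ n, L ⧸ lcs L n) := (⨆ p, limComp L p).subtype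

/-- The projection of the completion to `L / lcs L n`. -/
def Completion.proj (n : ℕ) : Completion L →ₗ[ℚ] L ⧸ lcs L n :=
  LinearMap.proj n ∘ₗ Completion.incl L

theorem Completion.ext {u v : Completion L} (h : ∀ n, proj L n u = proj L n v) : u = v :=
  Subtype.ext (funext h)

theorem br_limComp {p q : ℤ} {u v : ∀ n, L ⧸ lcs L n} (hu : u ∈ limComp L p)
    (hv : v ∈ limComp L q) : (fun n => brQ L n (u n) (v n)) ∈ limComp L (p + q) := by
  constructor
  · intro n
    obtain ⟨x, hx, hxu⟩ := hu.1 n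
    obtain ⟨y, hy, hyv⟩ := hv.1 n
    refine ⟨br x y, br_mem hx hy, ?_⟩
    change _ = brQ L n (u n) (v n)
    rw [← hxu, ← hyv]
    rfl
  · intro n
    obtain ⟨x, hx, hxu⟩ := hu.1 (n + 1)
    obtain ⟨y, hy, hyv⟩ := hv.1 (n + 1)
    have h1 := hu.2 n
    have h2 := hv.2 n
    change Submodule.factor _ (brQ L (n + 1) (u (n + 1)) (v (n + 1))) = brQ L n (u n) (v n)
    rw [← h1, ← h2, ← hxu, ← hyv]
    rfl

theorem br_iSup_limComp {u v : ∀ n, L ⧸ lcs L n} (hu : u ∈ ⨆ p, limComp L p)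
    (hv : v ∈ ⨆ p, limComp L p) : (fun n => brQ L n (u n) (v n)) ∈ ⨆ p, limComp L p := by
  refine Submodule.iSup_induction _
    (motive := fun u => (fun n => brQ L n (u n) (v n)) ∈ ⨆ p, limComp L p) hu ?_ ?_ ?_
  · intro p u hu
    refine Submodule.iSup_induction _
      (motive := fun v => (fun n => brQ L n (u n) (v n)) ∈ ⨆ p, limComp L p) hv ?_ ?_ ?_
    · exact fun q v hv => Submodule.mem_iSup_of_mem (p + q) (br_limComp L hu hv)
    · simp only [Pi.zero_apply, map_zero]
      exact zero_mem (⨆ p, limComp L p)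
    · intro v v' h h'
      simp only [Pi.add_apply, map_add]
      exact add_mem h h'
  · simp only [Pi.zero_apply, map_zero, LinearMap.zero_apply]
    exact zero_mem (⨆ p, limComp L p)
  · intro v v' h h'
    simp only [Pi.add_apply, map_add, LinearMap.add_apply]
    exact add_mem h h'

/-- The bracket of the completion, computed in each quotient. -/
def Completion.bracket : Completion L →ₗ[ℚ] Completion L →ₗ[ℚ] Completion L :=
  LinearMap.mk₂ ℚ
    (fun u v => Completion.mk L (fun n => brQ L n (u.1 n) (v.1 n)) (br_iSup_limComp L u.2 v.2))
    (fun u u' v => Completion.ext L fun n => by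
      change brQ L n (u.1 n + u'.1 n) (v.1 n) = brQ L n (u.1 n) (v.1 n) + brQ L n (u'.1 n) (v.1 n)
      simp)
    (fun c u v => Completion.ext L fun n => by
      change brQ L n (c • u.1 n) (v.1 n) = c • brQ L n (u.1 n) (v.1 n)
      simp)
    (fun u v v' => Completion.ext L fun n => by
      change brQ L n (u.1 n) (v.1 n + v'.1 n) = brQ L n (u.1 n) (v.1 n) + brQ L n (u.1 n) (v'.1 n)
      simp)
    (fun c u v => Completion.ext L fun n => by
      change brQ L n (u.1 n) (c • v.1 n) = c • brQ L n (u.1 n) (v.1 n)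
      simp)

theorem Completion.proj_bracket (n : ℕ) (u v : Completion L) :
    proj L n (bracket L u v) = brQ L n (proj L n u) (proj L n v) := rfl

theorem Completion.isInternal :
    DirectSum.IsInternal fun p => (limComp L p).comap (Completion.incl L) := by
  rw [DirectSum.isInternal_submodule_iff_iSupIndep_and_iSup_eq_top]
  constructor
  · intro p
    rw [Submodule.disjoint_def]
    intro u hu hu'
    refine Completion.ext L fun n => ?_
    have hind := iSupIndep_map_mkQ
      ((DirectSum.isInternal_submodule_iff_iSupIndep_and_iSup_eq_top _).1
        (SignedGLA.isInternal (L := L))).1 (lcs_homogeneous L n)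
    rw [map_zero]
    refine Submodule.disjoint_def.1 (hind p) _ (hu.1 n) ?_
    have h : (⨆ q, ⨆ (_ : q ≠ p), (limComp L q).comap (Completion.incl L)) ≤
        (⨆ q, ⨆ (_ : q ≠ p), (comp q).map (lcs L n).mkQ).comap (Completion.proj L n) :=
      iSup₂_le fun q hq v hv =>
        Submodule.mem_iSup_of_mem q (Submodule.mem_iSup_of_mem hq (hv.1 n))
    exact h hu'
  · rw [eq_top_iff]
    have h : ∀ u (hu : u ∈ ⨆ p, limComp L p),
        Completion.mk L u hu ∈ ⨆ p, (limComp L p).comap (Completion.incl L) := by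
      intro u hu
      induction hu using Submodule.iSup_induction' with
      | mem p u hu => exact Submodule.mem_iSup_of_mem p hu
      | zero => exact zero_mem (⨆ p, (limComp L p).comap (Completion.incl L))
      | add u v hu hv h h' => exact add_mem h h'
    exact fun u _ => h u.1 u.2

instance Completion.instSignedGLA : SignedGLA (Completion L) where
  comp p := (limComp L p).comap (Completion.incl L)
  isInternal := Completion.isInternal L
  br := Completion.bracket L
  br_mem := fun hx hy => br_limComp L hx hy
  br_antisymm := by
    intro p q u v hu hv
    refine Completion.ext L fun n => ?_
    obtain ⟨x, hx, hxu⟩ := hu.1 n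
    obtain ⟨y, hy, hyv⟩ := hv.1 n
    change _ = proj L n u at hxu
    change _ = proj L n v at hyv
    rw [map_neg, map_smul, proj_bracket, proj_bracket, ← hxu, ← hyv]
    exact congrArg (lcs L n).mkQ (SignedGLA.br_antisymm hx hy)
  br_jacobi := by
    intro p q r u v w hu hv hw
    refine Completion.ext L fun n => ?_
    obtain ⟨x, hx, hxu⟩ := hu.1 n
    obtain ⟨y, hy, hyv⟩ := hv.1 n
    obtain ⟨z, hz, hzw⟩ := hw.1 n
    change _ = proj L n u at hxu
    change _ = proj L n v at hyv
    change _ = proj L n w at hzw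
    simp only [map_add, map_smul, proj_bracket, map_zero]
    rw [← hxu, ← hyv, ← hzw]
    exact congrArg (lcs L n).mkQ (SignedGLA.br_jacobi hx hy hz)

variable {L}

theorem limComp_const {p : ℤ} {x : L} (hx : x ∈ comp p) :
    (fun n => (lcs L n).mkQ x) ∈ limComp L p :=
  ⟨fun _ => ⟨x, hx, rfl⟩, fun _ => rfl⟩

theorem iSup_limComp_const (x : L) : (fun n => (lcs L n).mkQ x) ∈ ⨆ p, limComp L p := by
  refine Submodule.iSup_induction _
    (motive := fun x => (fun n => (lcs L n).mkQ x) ∈ ⨆ p, limComp L p) (comp_iSup L x) ?_ ?_ ?_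
  · exact fun p x hx => Submodule.mem_iSup_of_mem p (limComp_const hx)
  · simp only [map_zero]
    exact zero_mem (⨆ p, limComp L p)
  · intro x y h h'
    simp only [map_add]
    exact add_mem h h'

/-- The canonical map from a graded Lie algebra to its completion. -/
def Completion.of (x : L) : Completion L := .mk L (fun n => (lcs L n).mkQ x) (iSup_limComp_const x)

/-- `y` is the sum of the series `∑ i, s i` in the completion, for the topology of the projective
limit: in each `L / L^n` the partial sums are eventually equal to `y`. -/
def HasSeriesSum (s : ℕ → Completion L) (y : Completion L) : Prop :=
  ∀ n, ∃ N, ∀ m ≥ N,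
    Completion.proj L n (∑ i ∈ Finset.range m, s i) = Completion.proj L n y

end Completion

/-- `y = (∑ i, c i • T ^ i) (u)`: the value at `u` of the power series with coefficients `c` in the
operator `T`. -/
def HasPowerSeriesValue {L : Type*} [AddCommGroup L] [Module ℚ L] [SignedGLA L]
    (c : ℕ → ℚ) (T : Completion L →ₗ[ℚ] Completion L) (u y : Completion L) : Prop :=
  HasSeriesSum (fun i => c i • (T ^ i) u) y

/-- The Taylor coefficients of `t / (e ^ t - 1)`, where `bernoulli 1 = -1 / 2`. -/
def toddCoeff (n : ℕ) : ℚ := bernoulli n / n.factorial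

/-- The Taylor coefficients of `e ^ t`. -/
def expCoeff (n : ℕ) : ℚ := 1 / n.factorial

/-! ## The Lawrence-Sullivan interval -/

/-- The three generators. -/
inductive Gen
  | a
  | b
  | x

/-- `a` and `b` have degree `-1` and `x` has degree `0`. -/
def genDeg : Gen → ℤ
  | Gen.a => -1
  | Gen.b => -1
  | Gen.x => 0

/-- The complete free graded Lie algebra on `a`, `b`, `x`. -/
abbrev LieABX : Type := Completion (FreeGLA genDeg)

/-- The generator `a`. -/
def genA : LieABX := Completion.of (FreeGLA.gen genDeg Gen.a)

/-- The generator `b`. -/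
def genB : LieABX := Completion.of (FreeGLA.gen genDeg Gen.b)

/-- The generator `x`. -/
def genX : LieABX := Completion.of (FreeGLA.gen genDeg Gen.x)

/-- `∂` is the differential of the Lawrence-Sullivan interval: `a` and `b` are Maurer-Cartan
elements and `∂ x = ad_x b + (ad_x / (e ^ ad_x - 1)) (b - a)`. -/
def IsLSDifferential (d : Differential LieABX) : Prop :=
  IsMaurerCartan d genA ∧ IsMaurerCartan d genB ∧
    HasPowerSeriesValue toddCoeff (br genX) (genB - genA) (d.toFun genX - br genX genB)

/-- `∂'` is the differential with `∂' a = -1/2 [a, a]`, `∂' b = -1/2 [b, b]` and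
`∂' x = (-ad_x / (e ^ (-ad_x) - 1)) (b)`. -/
def IsModifiedDifferential (d : Differential LieABX) : Prop :=
  d.toFun genA = -((1 / 2 : ℚ) • br genA genA) ∧
  d.toFun genB = -((1 / 2 : ℚ) • br genB genB) ∧
    HasPowerSeriesValue toddCoeff (-br genX) genB (d.toFun genX)

end

end LSInterval

namespace LSInterval

open LSInterval.SignedGLA Finset.HasAntidiagonal

noncomputable section

/-! ## Maps between completions -/

section Completion

variable {L : Type*} [AddCommGroup L] [Module ℚ L] [SignedGLA L]

/-! Only `∂'` is built by hand. The Lawrence–Sullivan differential is then defined as `φ ∂' φ⁻¹`, so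
`φ` commutes with the differentials by construction, and what remains is to verify the defining
formulas of the interval.

Write `D = ∂'` and `g(t) = (1 - e^(-t))/t`, the inverse of `-t/(e^(-t) - 1)`, so that `g(ad_x)(Dx) =
b`. Every derivation `D` of degree `-1` satisfies `D c = g(ad_x)(D²x) - ½[c, c]` for `c =
g(ad_x)(Dx)` (`derivation_psEval_oneSubExpNegDiv`). Here `c = b` and `D b = -½[b, b]`, hence
`g(ad_x)(D²x) = 0`, and `D²x = 0` because `g` is invertible.

The inverse of `φ` sends `b` to `e^(ad_x)(a - b)`. By `derivation_psEval_exp` and `((e^t - 1)/t) ·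
(-t/(e^(-t) - 1)) = e^t`, one has `D(e^(ad_x) u) = e^(ad_x)(D u + [b, u])`. For `u = a - b` the
right side is `-½ e^(ad_x)[u, u]`, and `e^(ad_x)` preserves brackets, so `φ⁻¹(b)` is Maurer–Cartan
for `∂'`. The formula for `∂x` reduces to `(t/(e^t - 1)) e^t = t/(e^t - 1) + t`.

For uniqueness, neither differentials nor morphisms are assumed continuous. Since there are finitely
many generators, each homogeneous element of the completion is a combination of generators plus a
finite sum of `[g, y_g]`, one for each generator `g`. An operator that kills the generators and is
compatible with these brackets therefore sends everything into ever deeper filtration steps, and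
vanishes (`eq_zero_of_gen`). -/

theorem SignedGLA.exists_mem_of_iSupIndep {M : Type*} [AddCommGroup M] [Module ℚ M]
    {C K : ℤ → Submodule ℚ M} (hC : iSupIndep C) (hK : ∀ q, K q ≤ C q) {p : ℤ} {z : M}
    (hz : z ∈ C p) (hz' : z ∈ ⨆ q, K q) : z ∈ K p := by
  have h : z ∈ K p ⊔ ⨆ q, ⨆ (_ : q ≠ p), K q := by
    refine (iSup_le fun j => ?_ : (⨆ q, K q) ≤ _) hz'
    by_cases hj : j = p
    · subst hj; exact le_sup_left
    · exact le_sup_of_le_right (le_iSup₂_of_le j hj le_rfl)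
  obtain ⟨k, hk, w, hw, rfl⟩ := Submodule.mem_sup.1 h
  have hw' : w ∈ C p := by
    have := sub_mem hz (hK p hk)
    rwa [add_sub_cancel_left] at this
  -- The remainder `w` lies both in `C p` and in the sum of the other `C q`, so independence kills
  -- it.
  rw [Submodule.disjoint_def.1 (hC p) w hw'
    ((iSup₂_mono fun j _ => hK j : (⨆ q, ⨆ (_ : q ≠ p), K q) ≤ _) hw), add_zero]
  exact hk

theorem comp_iSupIndep : iSupIndep (comp (L := L)) :=
  ((DirectSum.isInternal_submodule_iff_iSupIndep_and_iSup_eq_top _).1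
    (SignedGLA.isInternal (L := L))).1

@[elab_as_elim]
theorem SignedGLA.comp_induction {motive : L → Prop} (x : L)
    (mem : ∀ p, ∀ x ∈ comp (L := L) p, motive x) (zero : motive 0)
    (add : ∀ x y, motive x → motive y → motive (x + y)) : motive x :=
  Submodule.iSup_induction _ (motive := motive) (comp_iSup L x) mem zero add

/-- The Jacobi identity in derivation form. -/
theorem br_br {p q : ℤ} {x y : L} (hx : x ∈ comp p) (hy : y ∈ comp q) (z : L) :
    br (br x y) z = br x (br y z) - (-1 : ℚ) ^ (p * q) • br y (br x z) := by
  refine SignedGLA.comp_induction z (fun r z hz => ?_) (by simp) fun z z' h h' => ?_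
  · have h := br_jacobi hx hy hz
    rw [br_antisymm (br_mem hx hy) hz, br_antisymm hx hz, add_mul, zpow_add₀ (by norm_num)]
    -- Every sign depends only on the parities of the three degrees; in each of the eight cases the
    -- claim is the Jacobi identity up to a global sign.
    rcases Int.even_or_odd p with hp | hp <;> rcases Int.even_or_odd q with hq | hq <;>
      rcases Int.even_or_odd r with hr | hr <;>
    simp only [hp, hq, hr, Even.neg_one_zpow, Odd.neg_one_zpow, Even.mul_left, Even.mul_right,
      Odd.mul, mul_one, mul_neg, one_smul, neg_smul, map_neg, neg_neg] at h ⊢ <;>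
    · first
      | linear_combination (norm := module) h
      | linear_combination (norm := module) -h
  · simp only [map_add, h, h', smul_add]
    abel

theorem br_pow_lcs (n : ℕ) (x y : L) : (br x ^ n) y ∈ lcs L n := by
  induction n with
  | zero => trivial
  | succ n ih =>
    rw [pow_succ', Module.End.mul_apply]
    exact br_mem_lcs_succ L x _ ih

/-- The usual `[L^i, L^j] ⊆ L^(i+j)`, by induction on the first index through the Jacobi identity.
The extra `+ 1` comes from numbering the series from zero. -/
theorem br_mem_lcs {k l : ℕ} {x y : L} (hx : x ∈ lcs L k) (hy : y ∈ lcs L l) :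
    br x y ∈ lcs L (k + l + 1) := by
  induction k generalizing x y l with
  | zero =>
    rw [zero_add]
    exact br_mem_lcs_succ L x y hy
  | succ k ih =>
    induction hx using Submodule.span_induction with
    | mem x hx =>
      obtain ⟨u, v, hv, rfl⟩ := hx
      refine Submodule.iSup_induction _ (motive := fun v => br (br u v) y ∈ _)
        (lcs_homogeneous L k hv) ?_ (by simp) fun v v' h h' => by
          rw [map_add, map_add, LinearMap.add_apply]; exact add_mem h h'
      intro q v hv
      refine SignedGLA.comp_induction u (fun p u hu => ?_) (by simp) fun u u' h h' => by
          rw [map_add, LinearMap.add_apply, map_add, LinearMap.add_apply]; exact add_mem h h'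
      rw [br_br hu hv.2]
      refine sub_mem ?_ (Submodule.smul_mem _ _ ?_)
      · convert br_mem_lcs_succ L u _ (ih hv.1 hy) using 2
        omega
      · convert ih hv.1 (br_mem_lcs_succ L u y hy) using 2
        omega
    | zero => simp
    | add x x' _ _ h h' => rw [map_add, LinearMap.add_apply]; exact add_mem h h'
    | smul c x _ h => rw [map_smul, LinearMap.smul_apply]; exact Submodule.smul_mem _ _ h

namespace Completion

theorem factor_proj (n : ℕ) (u : Completion L) :
    Submodule.factor (lcs_succ_le L n) (proj L (n + 1) u) = proj L n u := by
  refine Submodule.iSup_induction _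
    (motive := fun u => Submodule.factor (lcs_succ_le L n) (u (n + 1)) = u n) u.2 ?_ ?_ ?_
  · exact fun p u hu => hu.2 n
  · simp
  · intro u v hu hv
    simp [hu, hv]

theorem exists_mkQ_eq_proj (n : ℕ) (u : Completion L) : ∃ l, (lcs L n).mkQ l = proj L n u :=
  Submodule.mkQ_surjective _ _

theorem exists_mem_comp_mkQ_eq_proj (n : ℕ) {p : ℤ} {u : Completion L} (hu : u ∈ comp p) :
    ∃ l ∈ comp p, (lcs L n).mkQ l = proj L n u := hu.1 n

theorem proj_eq_mkQ {n : ℕ} {u : Completion L} {l : L}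
    (h : (lcs L (n + 1)).mkQ l = proj L (n + 1) u) : (lcs L n).mkQ l = proj L n u := by
  rw [← factor_proj, ← h]
  rfl

theorem proj_br (n : ℕ) (u v : Completion L) :
    proj L n (br u v) = brQ L n (proj L n u) (proj L n v) := rfl

theorem proj_br_mkQ {n : ℕ} {u v : Completion L} {k l : L} (hk : (lcs L n).mkQ k = proj L n u)
    (hl : (lcs L n).mkQ l = proj L n v) : proj L n (br u v) = (lcs L n).mkQ (br k l) := by
  rw [proj_br, ← hk, ← hl]
  rfl

@[simp]
theorem proj_of (n : ℕ) (l : L) : proj L n (of l) = (lcs L n).mkQ l := rfl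

variable (L) in
/-- The filtration of the completion by the kernels of the projections. -/
def filt (n : ℕ) : Submodule ℚ (Completion L) := LinearMap.ker (proj L n)

theorem mem_filt {n : ℕ} {u : Completion L} : u ∈ filt L n ↔ proj L n u = 0 := Iff.rfl

theorem mem_filt_zero (u : Completion L) : u ∈ filt L 0 := by
  obtain ⟨l, hl⟩ := exists_mkQ_eq_proj 0 u
  rw [mem_filt, ← hl]
  exact (Submodule.Quotient.mk_eq_zero _).2 trivial

theorem filt_succ_le (n : ℕ) : filt L (n + 1) ≤ filt L n := fun u hu => by
  rw [mem_filt, ← factor_proj, mem_filt.1 hu, map_zero]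

theorem filt_antitone : Antitone (filt L) := antitone_nat_of_succ_le filt_succ_le

theorem eq_zero_of_mem_filt {u : Completion L} (h : ∀ n, u ∈ filt L n) : u = 0 :=
  Completion.ext L fun n => by rw [mem_filt.1 (h n), map_zero]

theorem of_mem_filt {n : ℕ} {l : L} (hl : l ∈ lcs L n) : of l ∈ filt L n :=
  (Submodule.Quotient.mk_eq_zero _).2 hl

theorem mem_lcs_of_mem_filt {n m : ℕ} (h : n ≤ m) {u : Completion L} (hu : u ∈ filt L n) {l : L}
    (hl : (lcs L m).mkQ l = proj L m u) : l ∈ lcs L n := by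
  induction m, h using Nat.le_induction with
  | base => exact (Submodule.Quotient.mk_eq_zero _).1 (hl.trans hu)
  | succ m _ ih => exact ih (proj_eq_mkQ hl)

theorem br_mem_filt_add {k l : ℕ} {u v : Completion L} (hu : u ∈ filt L k) (hv : v ∈ filt L l) :
    br u v ∈ filt L (k + l + 1) := by
  obtain ⟨x, hx⟩ := exists_mkQ_eq_proj (k + l + 1) u
  obtain ⟨y, hy⟩ := exists_mkQ_eq_proj (k + l + 1) v
  rw [mem_filt, proj_br_mkQ hx hy]
  have hx' : x ∈ lcs L k := mem_lcs_of_mem_filt (by omega) hu hx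
  have hy' : y ∈ lcs L l := mem_lcs_of_mem_filt (by omega) hv hy
  exact (Submodule.Quotient.mk_eq_zero _).2 (br_mem_lcs hx' hy')

theorem br_mem_filt_succ {n : ℕ} (u : Completion L) {v : Completion L} (hv : v ∈ filt L n) :
    br u v ∈ filt L (n + 1) := by
  simpa using br_mem_filt_add (mem_filt_zero u) hv

theorem of_mem_comp {p : ℤ} {x : L} (hx : x ∈ comp p) : of x ∈ comp (L := Completion L) p :=
  limComp_const hx

theorem of_br (x y : L) : of (br x y) = br (of x) (of y) := rfl

variable (L) in
/-- The inclusion of a graded Lie algebra in its completion, as a linear map. -/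
def ofLin : L →ₗ[ℚ] Completion L where
  toFun := of
  map_add' _ _ := rfl
  map_smul' _ _ := rfl

/-- The linear endomorphism of the completion given by a compatible family of homogeneous
endomorphisms of the quotients. -/
def mapFam (k : ℤ) (g : ∀ n, (L ⧸ lcs L n) →ₗ[ℚ] L ⧸ lcs L n)
    (hc : ∀ n u, Submodule.factor (lcs_succ_le L n) (g (n + 1) u)
      = g n (Submodule.factor (lcs_succ_le L n) u))
    (hdeg : ∀ n p, ∀ x ∈ comp (L := L) p,
      g n ((lcs L n).mkQ x) ∈ (comp (p + k)).map (lcs L n).mkQ) :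
    Completion L →ₗ[ℚ] Completion L :=
  (LinearMap.pi fun n => g n ∘ₗ LinearMap.proj n).restrict
    (p := ⨆ p, limComp L p) (q := ⨆ p, limComp L p) fun u hu => by
      -- The completion is the sum of the degreewise limits, in general smaller than the full
      -- inverse limit; homogeneity of the family keeps the image inside it.
      induction hu using Submodule.iSup_induction' with
      | mem p u hu =>
        refine Submodule.mem_iSup_of_mem (p + k) ⟨fun n => ?_, fun n => ?_⟩
        · obtain ⟨x, hx, hxu⟩ := hu.1 n
          simp only [LinearMap.pi_apply, LinearMap.comp_apply, LinearMap.proj_apply, ← hxu]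
          exact hdeg n p x hx
        · simp only [LinearMap.pi_apply, LinearMap.comp_apply, LinearMap.proj_apply]
          rw [hc, hu.2]
      | zero => rw [map_zero]; exact zero_mem (⨆ p, limComp L p)
      | add u v _ _ h h' => rw [map_add]; exact add_mem h h'

section mapFam

variable {k : ℤ} {g : ∀ n, (L ⧸ lcs L n) →ₗ[ℚ] L ⧸ lcs L n}
    {hc : ∀ n u, Submodule.factor (lcs_succ_le L n) (g (n + 1) u)
      = g n (Submodule.factor (lcs_succ_le L n) u)}
    {hdeg : ∀ n p, ∀ x ∈ comp (L := L) p,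
      g n ((lcs L n).mkQ x) ∈ (comp (p + k)).map (lcs L n).mkQ}

theorem proj_mapFam (n : ℕ) (u : Completion L) :
    proj L n (mapFam k g hc hdeg u) = g n (proj L n u) := rfl

theorem mapFam_mem {p : ℤ} {u : Completion L} (hu : u ∈ comp p) :
    mapFam k g hc hdeg u ∈ comp (p + k) := by
  refine ⟨fun n => ?_, fun n => factor_proj n (mapFam k g hc hdeg u)⟩
  change proj L n (mapFam k g hc hdeg u) ∈ _
  obtain ⟨l, hl, h⟩ := exists_mem_comp_mkQ_eq_proj n hu
  rw [proj_mapFam, ← h]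
  exact hdeg n p l hl

theorem mapFam_mem_filt {n : ℕ} {u : Completion L} (hu : u ∈ filt L n) :
    mapFam k g hc hdeg u ∈ filt L n := by
  rw [mem_filt, proj_mapFam, mem_filt.1 hu, map_zero]

end mapFam

/-- The continuous extension to the completion of a homogeneous linear map which is compatible with
the filtrations. -/
def extend (k : ℤ) (f : L →ₗ[ℚ] Completion L) (hf : ∀ n, ∀ x ∈ lcs L n, f x ∈ filt L n)
    (hdeg : ∀ p, ∀ x ∈ comp (L := L) p, f x ∈ comp (p + k)) : Completion L →ₗ[ℚ] Completion L :=
  mapFam k (fun n => (lcs L n).liftQ (proj L n ∘ₗ f) (hf n))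
    (fun n u => by
      obtain ⟨x, rfl⟩ := Submodule.mkQ_surjective _ u
      exact factor_proj n (f x))
    (fun n p x hx => (hdeg p x hx).1 n)

section extend

variable {k : ℤ} {f : L →ₗ[ℚ] Completion L} {hf : ∀ n, ∀ x ∈ lcs L n, f x ∈ filt L n}
  {hdeg : ∀ p, ∀ x ∈ comp (L := L) p, f x ∈ comp (p + k)}

theorem proj_extend {n : ℕ} {u : Completion L} {x : L} (h : (lcs L n).mkQ x = proj L n u) :
    proj L n (extend k f hf hdeg u) = proj L n (f x) := by
  change (lcs L n).liftQ (proj L n ∘ₗ f) (hf n) (proj L n u) = _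
  rw [← h]
  rfl

@[simp]
theorem extend_of (x : L) : extend k f hf hdeg (of x) = f x :=
  Completion.ext L fun _ => proj_extend rfl

theorem extend_mem {p : ℤ} {u : Completion L} (hu : u ∈ comp p) :
    extend k f hf hdeg u ∈ comp (p + k) := mapFam_mem hu

theorem extend_mem_filt {n : ℕ} {u : Completion L} (hu : u ∈ filt L n) :
    extend k f hf hdeg u ∈ filt L n := mapFam_mem_filt hu

end extend

end Completion

end Completion

/-! ## Power series in the adjoint action of an element of degree zero -/

/-- Truncated Cauchy product: the part of the square beyond the triangle contributes nothing. In a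
quotient by the lower central series nilpotency supplies `ha`. -/
theorem sum_range_sum_range_eq_sum_antidiagonal {V : Type*} [AddCommMonoid V] (a : ℕ → ℕ → V)
    (N : ℕ) (ha : ∀ k l, N ≤ k + l → a k l = 0) :
    ∑ k ∈ Finset.range N, ∑ l ∈ Finset.range N, a k l
      = ∑ n ∈ Finset.range N, ∑ p ∈ antidiagonal n, a p.1 p.2 := by
  rw [← Finset.sum_product', Finset.sum_sigma']
  rw [← Finset.sum_filter_of_ne (p := fun p : ℕ × ℕ => p.1 + p.2 < N)
    fun p _ hp => not_le.1 fun h => hp (ha _ _ h)]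
  refine Finset.sum_bij' (fun p _ => ⟨p.1 + p.2, p⟩) (fun s _ => s.2) ?_ ?_ ?_ ?_ ?_
  · rintro ⟨k, l⟩ h
    simpa using (Finset.mem_filter.1 h).2
  · rintro ⟨n, k, l⟩ h
    simp only [Finset.mem_sigma, Finset.mem_range, mem_antidiagonal, Finset.mem_filter,
      Finset.mem_product] at h ⊢
    omega
  · simp
  · rintro ⟨n, k, l⟩ h
    simp only [Finset.mem_sigma, mem_antidiagonal] at h
    simp [h.2]
  · simp

section Completion

variable {L : Type*} [AddCommGroup L] [Module ℚ L] [SignedGLA L]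

namespace Completion

theorem factor_brQ (n : ℕ) (u v : L ⧸ lcs L (n + 1)) :
    Submodule.factor (lcs_succ_le L n) (brQ L (n + 1) u v)
      = brQ L n (Submodule.factor (lcs_succ_le L n) u) (Submodule.factor (lcs_succ_le L n) v) := by
  obtain ⟨x, rfl⟩ := Submodule.mkQ_surjective _ u
  obtain ⟨y, rfl⟩ := Submodule.mkQ_surjective _ v
  rfl

theorem factor_brQ_pow (n i : ℕ) (u v : L ⧸ lcs L (n + 1)) :
    Submodule.factor (lcs_succ_le L n) ((brQ L (n + 1) u ^ i) v)
      = (brQ L n (Submodule.factor (lcs_succ_le L n) u) ^ i)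
        (Submodule.factor (lcs_succ_le L n) v) := by
  induction i with
  | zero => rfl
  | succ i ih => simp only [pow_succ', Module.End.mul_apply, factor_brQ, ih]

theorem brQ_pow_mkQ (n i : ℕ) (x y : L) :
    (brQ L n ((lcs L n).mkQ x) ^ i) ((lcs L n).mkQ y) = (lcs L n).mkQ ((br x ^ i) y) := by
  induction i with
  | zero => rfl
  | succ i ih =>
    simp only [pow_succ', Module.End.mul_apply, ih]
    rfl

/-- This nilpotency turns every power series in an adjoint action into a polynomial in each
quotient. -/
theorem brQ_pow_self (n : ℕ) (u : L ⧸ lcs L n) : brQ L n u ^ n = 0 := by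
  refine LinearMap.ext fun v => ?_
  obtain ⟨x, rfl⟩ := Submodule.mkQ_surjective _ u
  obtain ⟨y, rfl⟩ := Submodule.mkQ_surjective _ v
  rw [brQ_pow_mkQ]
  exact (Submodule.Quotient.mk_eq_zero _).2 (br_pow_lcs n x y)

theorem br_pow_mem_comp {x : L} (hx : x ∈ comp 0) (i : ℕ) {p : ℤ} {y : L} (hy : y ∈ comp p) :
    (br x ^ i) y ∈ comp p := by
  induction i with
  | zero => exact hy
  | succ i ih =>
    rw [pow_succ', Module.End.mul_apply]
    simpa using br_mem hx ih

theorem proj_br_pow (n i : ℕ) (x u : Completion L) :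
    proj L n ((br x ^ i) u) = (brQ L n (proj L n x) ^ i) (proj L n u) := by
  induction i with
  | zero => rfl
  | succ i ih => rw [pow_succ', pow_succ', Module.End.mul_apply, Module.End.mul_apply, proj_br, ih]

theorem br_pow_mem_filt {n i : ℕ} (h : n ≤ i) (x u : Completion L) : (br x ^ i) u ∈ filt L n := by
  refine filt_antitone h ?_
  rw [mem_filt, proj_br_pow, brQ_pow_self, LinearMap.zero_apply]

/-- `psEval hx f u` is the value `f(ad_x)(u)` of the power series `f` in the operator `ad_x`, for
`x` of degree zero. -/
def psEval {x : Completion L} (hx : x ∈ comp 0) (f : PowerSeries ℚ) :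
    Completion L →ₗ[ℚ] Completion L :=
  mapFam 0 (fun n => ∑ i ∈ Finset.range n, f.coeff i • brQ L n (proj L n x) ^ i)
    (fun n u => by
      -- Level `n + 1` has one more term than level `n`, the one of exponent `n`, and `brQ_pow_self`
      -- kills it after projection.
      rw [Finset.sum_range_succ, ← factor_proj n x]
      simp only [LinearMap.add_apply, LinearMap.sum_apply, LinearMap.smul_apply, map_add, map_sum,
        map_smul, factor_brQ_pow, brQ_pow_self, LinearMap.zero_apply, smul_zero, add_zero])
    (fun n p y hy => by
      obtain ⟨k, hk, h⟩ := exists_mem_comp_mkQ_eq_proj n hx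
      simp only [LinearMap.sum_apply, LinearMap.smul_apply, ← h, brQ_pow_mkQ, add_zero]
      exact sum_mem fun i _ => Submodule.smul_mem _ _ ⟨_, br_pow_mem_comp hk i hy, rfl⟩)

section psEval

variable {x : Completion L} (hx : x ∈ comp 0)

/-- Any truncation beyond `n` gives the same value at level `n`; the freedom in `m` is used to align
sums of different lengths. -/
theorem proj_psEval {n m : ℕ} (h : n ≤ m) (f : PowerSeries ℚ) (u : Completion L) :
    proj L n (psEval hx f u) = ∑ i ∈ Finset.range m, f.coeff i • proj L n ((br x ^ i) u) := by
  rw [psEval, proj_mapFam, LinearMap.sum_apply, Finset.sum_congr rfl fun i _ => ?_]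
  · refine Finset.sum_subset (Finset.range_subset_range.2 h) fun i _ hi => ?_
    rw [mem_filt.1 (br_pow_mem_filt (by simpa using hi) x u), smul_zero]
  · rw [LinearMap.smul_apply, proj_br_pow]

theorem psEval_mem {p : ℤ} (f : PowerSeries ℚ) {u : Completion L} (hu : u ∈ comp p) :
    psEval hx f u ∈ comp p := by
  have h : psEval hx f u ∈ comp (p + 0) := mapFam_mem hu
  rwa [add_zero] at h

theorem hasPowerSeriesValue_psEval {c : ℕ → ℚ} {f : PowerSeries ℚ} (h : ∀ i, f.coeff i = c i)
    (u : Completion L) : HasPowerSeriesValue c (br x) u (psEval hx f u) := fun n =>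
  ⟨n, fun m hm => by
    rw [proj_psEval hx hm]
    simp [h]⟩

theorem psEval_add (f g : PowerSeries ℚ) (u : Completion L) :
    psEval hx (f + g) u = psEval hx f u + psEval hx g u :=
  Completion.ext L fun n => by
    simp only [map_add, proj_psEval hx le_rfl, add_smul, Finset.sum_add_distrib]

theorem psEval_one (u : Completion L) : psEval hx 1 u = u :=
  Completion.ext L fun n => by
    -- Truncating at `n + 1` keeps the index `0` in range even when `n = 0`.
    rw [proj_psEval hx n.le_succ, Finset.sum_eq_single 0]
    · simp
    · intro i _ hi
      simp [PowerSeries.coeff_one, hi]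
    · simp

theorem psEval_X (u : Completion L) : psEval hx PowerSeries.X u = br x u :=
  Completion.ext L fun n => by
    rw [proj_psEval hx (n.le_add_right 2), Finset.sum_eq_single 1]
    · simp
    · intro i _ hi
      simp [PowerSeries.coeff_X, hi]
    · simp

theorem br_pow_br_pow (k l : ℕ) (x u : Completion L) :
    (br x ^ k) ((br x ^ l) u) = (br x ^ (k + l)) u := by
  rw [pow_add, Module.End.mul_apply]

/-- Makes evaluation at `ad_x` multiplicative, so identities between power series become identities
between operators. -/
theorem psEval_mul (f g : PowerSeries ℚ) (u : Completion L) :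
    psEval hx (f * g) u = psEval hx f (psEval hx g u) :=
  Completion.ext L fun n => by
    have h : ∀ k, proj L n ((br x ^ k) (psEval hx g u))
        = ∑ l ∈ Finset.range n, g.coeff l • proj L n ((br x ^ (k + l)) u) := fun k => by
      rw [proj_br_pow, proj_psEval hx le_rfl, map_sum]
      simp only [map_smul, ← proj_br_pow, br_pow_br_pow]
    rw [proj_psEval hx le_rfl, proj_psEval hx le_rfl]
    simp only [h, Finset.smul_sum, smul_smul]
    rw [sum_range_sum_range_eq_sum_antidiagonal
      (fun k l => (f.coeff k * g.coeff l) • proj L n ((br x ^ (k + l)) u))]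
    · refine Finset.sum_congr rfl fun i _ => ?_
      rw [PowerSeries.coeff_mul, Finset.sum_smul]
      refine Finset.sum_congr rfl fun p hp => ?_
      rw [mem_antidiagonal.1 hp]
    · intro k l hkl
      rw [mem_filt.1 (br_pow_mem_filt hkl x u), smul_zero]

theorem psEval_neg (f : PowerSeries ℚ) (hx' : -x ∈ comp 0) (u : Completion L) :
    psEval hx' f u = psEval hx (PowerSeries.rescale (-1) f) u :=
  Completion.ext L fun n => by
    rw [proj_psEval hx' le_rfl, proj_psEval hx le_rfl]
    refine Finset.sum_congr rfl fun i _ => ?_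
    rw [PowerSeries.coeff_rescale, map_neg, neg_pow, mul_comm, mul_smul]
    congr 1
    rcases i.even_or_odd with h | h <;> simp [h.neg_one_pow]

/-- As `φ` respects the filtration, at each level it may be computed on a partial sum, where only
compatibility with brackets is needed. -/
theorem map_psEval {φ : Completion L →ₗ[ℚ] Completion L}
    (hbr : ∀ u v, φ (br u v) = br (φ u) (φ v)) (hφ : ∀ n, ∀ u ∈ filt L n, φ u ∈ filt L n)
    (hx' : φ x ∈ comp 0) (f : PowerSeries ℚ) (u : Completion L) :
    φ (psEval hx f u) = psEval hx' f (φ u) :=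
  Completion.ext L fun n => by
    have hpow : ∀ i v, φ ((br x ^ i) v) = (br (φ x) ^ i) (φ v) := fun i v => by
      induction i with
      | zero => rfl
      | succ i ih => rw [pow_succ', pow_succ', Module.End.mul_apply, Module.End.mul_apply, hbr, ih]
    have h : psEval hx f u - ∑ i ∈ Finset.range n, f.coeff i • (br x ^ i) u ∈ filt L n := by
      rw [mem_filt, map_sub, proj_psEval hx le_rfl]
      simp
    have h' := mem_filt.1 (hφ n _ h)
    rw [map_sub, map_sub, sub_eq_zero] at h'
    rw [h', proj_psEval hx' le_rfl]
    simp only [map_sum, map_smul, hpow]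

/-- Puts a bracket of two series in the double-sum form of `proj_derivation_psEval`, so that the two
can be compared coefficient by coefficient. -/
theorem proj_br_psEval (n : ℕ) (f g : PowerSeries ℚ) (u v : Completion L) :
    proj L n (br (psEval hx f u) (psEval hx g v)) = ∑ m ∈ Finset.range n,
      ∑ p ∈ antidiagonal m, (f.coeff p.1 * g.coeff p.2) •
        proj L n (br ((br x ^ p.1) u) ((br x ^ p.2) v)) := by
  rw [proj_br, proj_psEval hx le_rfl, proj_psEval hx le_rfl,
    ← sum_range_sum_range_eq_sum_antidiagonal (fun k l => (f.coeff k * g.coeff l) •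
      proj L n (br ((br x ^ k) u) ((br x ^ l) v)))]
  · simp only [map_sum, LinearMap.sum_apply, map_smul, LinearMap.smul_apply, proj_br, smul_smul,
      Finset.smul_sum]
    rw [Finset.sum_comm]
    refine Finset.sum_congr rfl fun k _ => Finset.sum_congr rfl fun l _ => ?_
    rw [mul_comm]
  · intro k l hkl
    rw [mem_filt.1 (filt_antitone (by omega)
      (br_mem_filt_add (br_pow_mem_filt le_rfl x u) (br_pow_mem_filt le_rfl x v))), smul_zero]

end psEval

end Completion

end Completion

/-! ## Derivations applied to power series in the adjoint action -/

section Completion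

variable {L : Type*} [AddCommGroup L] [Module ℚ L] [SignedGLA L]

/-- The adjoint action of an element of degree zero is a derivation. -/
theorem br_br_right {x : L} (hx : x ∈ comp 0) (u v : L) :
    br x (br u v) = br (br x u) v + br u (br x v) := by
  refine SignedGLA.comp_induction u (fun p u hu => ?_) (by simp) fun u u' h h' => ?_
  · rw [br_br hx hu]
    simp
  · simp only [map_add, LinearMap.add_apply, h, h']
    abel

theorem br_pow_br {x : L} (hx : x ∈ comp 0) (n : ℕ) (u v : L) :
    (br x ^ n) (br u v) = ∑ p ∈ antidiagonal n,
      n.choose p.1 • br ((br x ^ p.1) u) ((br x ^ p.2) v) := by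
  induction n with
  | zero => simp
  | succ n ih =>
    rw [Finset.sum_antidiagonal_choose_succ_nsmul
      (fun k l => br ((br x ^ k) u) ((br x ^ l) v)) n, pow_succ', Module.End.mul_apply, ih]
    simp only [map_sum, map_nsmul, br_br_right hx, smul_add, Finset.sum_add_distrib,
      pow_succ', Module.End.mul_apply]
    rw [add_comm]
    congr 1
    refine Finset.sum_congr rfl fun p hp => ?_
    rw [Nat.choose_symm_of_eq_add (mem_antidiagonal.1 hp).symm]

/-- Moving `D` through the product leaves `∑ ad_x^i ad_(Dx) ad_x^j` over `i + j = n`. Expanding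
`ad_x^i` over the bracket, the coefficient of `[ad_x^k Dx, ad_x^(n-k) u]` is the hockey-stick sum of
`i.choose k` for `i ≤ n`, which is `(n+1).choose (k+1)`. The induction encodes this sum through
Pascal's rule. -/
theorem derivation_br_pow {x : L} (hx : x ∈ comp 0) {D : L →ₗ[ℚ] L}
    (hD : ∀ u, D (br x u) = br (D x) u + br x (D u)) (n : ℕ) (u : L) :
    D ((br x ^ (n + 1)) u) = (br x ^ (n + 1)) (D u) + ∑ p ∈ antidiagonal n,
      (n + 1).choose (p.1 + 1) • br ((br x ^ p.1) (D x)) ((br x ^ p.2) u) := by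
  induction n with
  | zero => simp [hD, add_comm]
  | succ n ih =>
    have h0 : (n + 1).choose (n + 1 + 1) = 0 := Nat.choose_succ_self _
    rw [Finset.sum_congr rfl fun p _ => by rw [Nat.choose_succ_succ' (n + 1), add_smul],
      Finset.sum_add_distrib, Finset.Nat.sum_antidiagonal_succ, Finset.Nat.sum_antidiagonal_succ',
      pow_succ', Module.End.mul_apply, hD, ih]
    have hpow : ∀ k v, (br x ^ (k + 1)) v = br x ((br x ^ k) v) := fun k v => by
      rw [pow_succ', Module.End.mul_apply]
    simp only [Nat.choose_zero_right, pow_zero, h0, zero_nsmul, one_nsmul, Module.End.one_apply,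
      Module.End.mul_apply]
    rw [map_add, map_sum]
    simp only [map_nsmul, br_br_right hx, nsmul_add, Finset.sum_add_distrib]
    simp only [hpow]
    abel

namespace Completion

variable {x : Completion L} (hx : x ∈ comp 0)

/-- The exponential of a derivation is multiplicative: in the Leibniz formula, `n.choose k / n!`
splits as `1/k! · 1/(n-k)!`. -/
theorem psEval_exp_br (u v : Completion L) :
    psEval hx (PowerSeries.exp ℚ) (br u v)
      = br (psEval hx (PowerSeries.exp ℚ) u) (psEval hx (PowerSeries.exp ℚ) v) :=
  Completion.ext L fun N => by
    rw [proj_br_psEval, proj_psEval hx le_rfl]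
    refine Finset.sum_congr rfl fun n _ => ?_
    rw [br_pow_br hx, map_sum, Finset.smul_sum]
    refine Finset.sum_congr rfl fun p hp => ?_
    rw [← Nat.cast_smul_eq_nsmul ℚ, map_smul, smul_smul, ← mem_antidiagonal.1 hp]
    congr 1
    simp only [PowerSeries.coeff_exp, Algebra.algebraMap_self, RingHom.id_apply,
      Nat.cast_add_choose]
    field_simp

/-- Common source of the two derivation formulas below: each comes from a series `f` for which the
coefficient `f_(k+l+1) · (k+l+1).choose (k+1)` factors, possibly after symmetrising in `k` and `l`.
-/
theorem proj_derivation_psEval {D : Completion L →ₗ[ℚ] Completion L}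
    (hD : ∀ u, D (br x u) = br (D x) u + br x (D u)) (hD' : ∀ n, ∀ u ∈ filt L n, D u ∈ filt L n)
    (N : ℕ) (f : PowerSeries ℚ) (u : Completion L) :
    proj L N (D (psEval hx f u) - psEval hx f (D u)) = ∑ n ∈ Finset.range N,
      ∑ p ∈ antidiagonal n, (f.coeff (n + 1) * (n + 1).choose (p.1 + 1)) •
        proj L N (br ((br x ^ p.1) (D x)) ((br x ^ p.2) u)) := by
  -- Truncation at `N + 1`: the terms of exponent `0` cancel and exactly the exponents `n + 1` with
  -- `n < N` remain.
  have h : psEval hx f u - ∑ i ∈ Finset.range (N + 1), f.coeff i • (br x ^ i) u ∈ filt L N := by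
    rw [mem_filt, map_sub, proj_psEval hx N.le_succ]
    simp
  have h' := mem_filt.1 (hD' N _ h)
  rw [map_sub, map_sub, sub_eq_zero] at h'
  rw [map_sub, h', proj_psEval hx N.le_succ, Finset.sum_range_succ', Finset.sum_range_succ']
  simp only [map_add, map_sum, map_smul, derivation_br_pow hx hD, smul_add, Finset.sum_add_distrib,
    Finset.smul_sum, map_nsmul, mul_smul, Nat.cast_smul_eq_nsmul, pow_zero, Module.End.one_apply]
  abel

/-- The power series `(e^t - 1) / t`. -/
def expSubOneDiv : PowerSeries ℚ := PowerSeries.mk fun n => 1 / (n + 1).factorial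

/-- For `f = e^t` the coefficient is `1/(k+1)! · 1/l!`, the product of the coefficients of `(e^t -
1)/t` and `e^t`. -/
theorem derivation_psEval_exp {D : Completion L →ₗ[ℚ] Completion L}
    (hD : ∀ u, D (br x u) = br (D x) u + br x (D u)) (hD' : ∀ n, ∀ u ∈ filt L n, D u ∈ filt L n)
    (u : Completion L) :
    D (psEval hx (PowerSeries.exp ℚ) u) = psEval hx (PowerSeries.exp ℚ) (D u)
      + br (psEval hx expSubOneDiv (D x)) (psEval hx (PowerSeries.exp ℚ) u) := by
  rw [← sub_eq_iff_eq_add']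
  refine Completion.ext L fun N => ?_
  rw [proj_derivation_psEval hx hD hD', proj_br_psEval]
  refine Finset.sum_congr rfl fun n _ => Finset.sum_congr rfl fun p hp => ?_
  congr 1
  rw [← mem_antidiagonal.1 hp, show p.1 + p.2 + 1 = (p.1 + 1) + p.2 by ring,
    Nat.cast_add_choose, expSubOneDiv]
  simp only [PowerSeries.coeff_exp, PowerSeries.coeff_mk, Algebra.algebraMap_self, RingHom.id_apply]
  field_simp

/-- The power series `(1 - e^(-t)) / t`. -/
def oneSubExpNegDiv : PowerSeries ℚ := PowerSeries.rescale (-1) expSubOneDiv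

/-- All `ad_x^k Dx` have degree `-1`, so their brackets are symmetric and the coefficients may be
averaged over `k ↔ l`. With `n = k + l`, Pascal's rule gives `(n+1).choose (k+1) + (n+1).choose
(l+1) = (n+2).choose (k+1)`; multiplied by `(-1)^(n+1)/(n+2)!` this is minus the product of the
coefficients of the series at `k` and `l`. The averaging is the source of the factor `1/2`. -/
theorem derivation_psEval_oneSubExpNegDiv {D : Completion L →ₗ[ℚ] Completion L}
    (hD : ∀ u, D (br x u) = br (D x) u + br x (D u)) (hD' : ∀ n, ∀ u ∈ filt L n, D u ∈ filt L n)
    (hDx : D x ∈ comp (-1)) :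
    D (psEval hx oneSubExpNegDiv (D x)) = psEval hx oneSubExpNegDiv (D (D x))
      - (1 / 2 : ℚ) • br (psEval hx oneSubExpNegDiv (D x)) (psEval hx oneSubExpNegDiv (D x)) := by
  have hsymm : ∀ k l, br ((br x ^ k) (D x)) ((br x ^ l) (D x))
      = br ((br x ^ l) (D x)) ((br x ^ k) (D x)) := fun k l => by
    rw [br_antisymm (br_pow_mem_comp hx k hDx) (br_pow_mem_comp hx l hDx)]
    simp
  rw [sub_eq_add_neg, ← sub_eq_iff_eq_add']
  refine Completion.ext L fun N => ?_
  rw [proj_derivation_psEval hx hD hD', map_neg, map_smul, proj_br_psEval, Finset.smul_sum,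
    ← Finset.sum_neg_distrib]
  refine Finset.sum_congr rfl fun n _ => ?_
  have hswap : ∀ F : ℕ × ℕ → (L ⧸ lcs L N), ∑ p ∈ antidiagonal n, F p
      = (1 / 2 : ℚ) • ∑ p ∈ antidiagonal n, (F p + F p.swap) := fun F => by
    rw [Finset.sum_add_distrib, Finset.Nat.sum_antidiagonal_swap]
    module
  rw [hswap, ← smul_neg, ← Finset.sum_neg_distrib]
  congr 1
  refine Finset.sum_congr rfl fun p hp => ?_
  rw [Prod.fst_swap, Prod.snd_swap, hsymm p.2 p.1, ← add_smul, ← neg_smul]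
  congr 1
  rw [← mul_add, ← Nat.cast_add, Nat.choose_symm_of_eq_add
      (show n + 1 = (p.2 + 1) + p.1 by have := mem_antidiagonal.1 hp; omega),
    add_comm ((n + 1).choose _), ← Nat.choose_succ_succ, ← mem_antidiagonal.1 hp,
    show (p.1 + p.2 + 1).succ = (p.1 + 1) + (p.2 + 1) by omega, Nat.succ_eq_add_one,
    Nat.cast_add_choose, oneSubExpNegDiv, expSubOneDiv]
  simp only [PowerSeries.coeff_rescale, PowerSeries.coeff_mk,
    show p.1 + p.2 + 1 + 1 = (p.1 + 1) + (p.2 + 1) by omega]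
  field_simp
  ring

end Completion

end Completion

/-! ## Morphisms and derivations out of a free graded Lie algebra -/

section Free

variable {X : Type*} {deg : X → ℤ} {M : Type*} [AddCommGroup M] [Module ℚ M]

/-- The linear map on the free non-associative algebra with given values on the words. -/
def wordLin (f : FreeMagma X → M) : Words X →ₗ[ℚ] M :=
  (MonoidAlgebra.basis (FreeMagma X) ℚ).constr ℚ f

@[simp]
theorem wordLin_word (f : FreeMagma X → M) (w : FreeMagma X) : wordLin f (word w) = f w := by
  rw [wordLin, word, ← MonoidAlgebra.basis_apply, Module.Basis.constr_basis]

@[elab_as_elim]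
theorem words_induction {motive : Words X → Prop} (f : Words X) (word : ∀ w, motive (word w))
    (zero : motive 0) (add : ∀ f g, motive f → motive g → motive (f + g))
    (smul : ∀ (c : ℚ) f, motive f → motive (c • f)) : motive f := by
  induction f using MonoidAlgebra.induction_linear with
  | zero => exact zero
  | add f g hf hg => exact add f g hf hg
  | single w c =>
    have h : (MonoidAlgebra.single w c : Words X) = c • LSInterval.word w := by simp
    rw [h]
    exact smul _ _ (word w)

variable (deg) in
/-- The class of an element of the free non-associative algebra in the free graded Lie algebra. -/
def FreeGLA.mk : Words X →ₗ[ℚ] FreeGLA deg := (relIdeal deg).mkQ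

namespace FreeGLA

theorem mk_surjective : Function.Surjective (mk deg) := Submodule.mkQ_surjective _

theorem mk_mul (f g : Words X) : mk deg (f * g) = br (mk deg f) (mk deg g) := rfl

theorem mk_eq_zero {f : Words X} : mk deg f = 0 ↔ f ∈ relIdeal deg :=
  Submodule.Quotient.mk_eq_zero _

theorem mk_mem_comp {p : ℤ} {f : Words X} (hf : f ∈ wordComp deg p) : mk deg f ∈ comp p :=
  ⟨f, hf, rfl⟩

theorem exists_mk_eq_of_mem_comp {p : ℤ} {x : FreeGLA deg} (hx : x ∈ comp p) :
    ∃ f ∈ wordComp deg p, mk deg f = x := hx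

theorem gen_mem_comp (x : X) : gen deg x ∈ comp (deg x) :=
  mk_mem_comp (word_mem deg (FreeMagma.of x))

theorem mk_word_of (x : X) : mk deg (word (FreeMagma.of x)) = gen deg x := rfl

/-- The linear map out of the free graded Lie algebra induced by a linear map which vanishes on the
relations. -/
def liftLin (f : Words X →ₗ[ℚ] M) (hf : ∀ r ∈ relIdeal deg, f r = 0) : FreeGLA deg →ₗ[ℚ] M :=
  (relIdeal deg).liftQ f hf

@[simp]
theorem liftLin_mk (f : Words X →ₗ[ℚ] M) (hf : ∀ r ∈ relIdeal deg, f r = 0) (r : Words X) :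
    liftLin f hf (mk deg r) = f r := rfl

end FreeGLA

variable {N : Type*} [AddCommGroup N] [Module ℚ N] [SignedGLA N]

/-- The value of a bracketed word in a graded Lie algebra. -/
def evalWord (v : X → N) : FreeMagma X → N
  | FreeMagma.of x => v x
  | FreeMagma.mul a b => br (evalWord v a) (evalWord v b)

theorem evalWord_mem {v : X → N} (hv : ∀ x, v x ∈ comp (deg x)) (w : FreeMagma X) :
    evalWord v w ∈ comp (wordDeg deg w) := by
  induction w using FreeMagma.rec with
  | of x => exact hv x
  | mul a b ha hb => exact br_mem ha hb

theorem wordLin_evalWord_mul (v : X → N) (f g : Words X) :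
    wordLin (evalWord v) (f * g) = br (wordLin (evalWord v) f) (wordLin (evalWord v) g) := by
  induction f using words_induction with
  | word u =>
    induction g using words_induction with
    | word w =>
      rw [word_mul_word, wordLin_word, wordLin_word, wordLin_word]
      rfl
    | zero => simp
    | add g g' h h' => rw [mul_add, map_add, h, h', map_add, map_add]
    | smul c g h => rw [mul_smul_comm, map_smul, h, map_smul, map_smul]
  | zero => simp
  | add f f' h h' => rw [add_mul, map_add, h, h', map_add, map_add, LinearMap.add_apply]
  | smul c f h => rw [smul_mul_assoc, map_smul, h, map_smul, map_smul, LinearMap.smul_apply]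

/-- The kernel of the evaluation is itself one of the ideals whose intersection is `relIdeal`. -/
theorem wordLin_evalWord_eq_zero {v : X → N} (hv : ∀ x, v x ∈ comp (deg x)) :
    ∀ r ∈ relIdeal deg, wordLin (evalWord v) r = 0 := by
  suffices h : relIdeal deg ≤ LinearMap.ker (wordLin (evalWord v)) from h
  refine sInf_le ⟨fun a b => ?_, fun a b c => ?_, fun f g hg => ?_, fun f hf g => ?_⟩
  · simp only [LinearMap.mem_ker, map_add, map_smul, wordLin_evalWord_mul, wordLin_word]
    rw [br_antisymm (evalWord_mem hv a) (evalWord_mem hv b)]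
    simp
  · simp only [LinearMap.mem_ker, map_add, map_smul, wordLin_evalWord_mul, wordLin_word]
    exact br_jacobi (evalWord_mem hv a) (evalWord_mem hv b) (evalWord_mem hv c)
  · rw [LinearMap.mem_ker, wordLin_evalWord_mul, LinearMap.mem_ker.1 hg, map_zero]
  · rw [LinearMap.mem_ker, wordLin_evalWord_mul, LinearMap.mem_ker.1 hf, map_zero,
      LinearMap.zero_apply]

namespace FreeGLA

/-- The morphism of graded Lie algebras with given values on the generators. -/
def lift (v : X → N) (hv : ∀ x, v x ∈ comp (deg x)) : FreeGLA deg →ₗ[ℚ] N :=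
  liftLin (wordLin (evalWord v)) (wordLin_evalWord_eq_zero hv)

section lift

variable {v : X → N} (hv : ∀ x, v x ∈ comp (deg x))

theorem lift_gen (x : X) : lift v hv (gen deg x) = v x := by
  rw [lift, ← mk_word_of, liftLin_mk, wordLin_word, evalWord]

theorem lift_br (x y : FreeGLA deg) :
    lift v hv (br x y) = br (lift v hv x) (lift v hv y) := by
  obtain ⟨f, rfl⟩ := mk_surjective x
  obtain ⟨g, rfl⟩ := mk_surjective y
  rw [← mk_mul, lift, liftLin_mk, liftLin_mk, liftLin_mk, wordLin_evalWord_mul]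

theorem lift_mem {p : ℤ} {x : FreeGLA deg} (hx : x ∈ comp p) : lift v hv x ∈ comp p := by
  obtain ⟨f, hf, rfl⟩ := exists_mk_eq_of_mem_comp hx
  rw [lift, liftLin_mk]
  suffices h : wordComp deg p ≤ (comp p).comap (wordLin (evalWord v)) from h hf
  refine Submodule.span_le.2 ?_
  rintro _ ⟨w, rfl, rfl⟩
  simpa using evalWord_mem hv w

end lift

end FreeGLA

/-- The sign operator `x ↦ (-1)^|x| x` on words. -/
def wordSign (deg : X → ℤ) : Words X →ₗ[ℚ] Words X :=
  wordLin fun w => (-1 : ℚ) ^ wordDeg deg w • word w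

theorem wordSign_of_mem {p : ℤ} {f : Words X} (hf : f ∈ wordComp deg p) :
    wordSign deg f = (-1 : ℚ) ^ p • f := by
  suffices h : wordComp deg p ≤ LinearMap.ker (wordSign deg - (-1 : ℚ) ^ p • LinearMap.id) by
    simpa [sub_eq_zero] using h hf
  refine Submodule.span_le.2 ?_
  rintro _ ⟨w, rfl, rfl⟩
  simp [wordSign, -MonoidAlgebra.smul_single]

theorem wordSign_mem_relIdeal {f : Words X} (hf : f ∈ relIdeal deg) :
    wordSign deg f ∈ relIdeal deg := by
  refine Submodule.iSup_induction _ (motive := fun f => wordSign deg f ∈ _)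
    (relIdeal_homogeneous deg hf) (fun p f hf => ?_) (by simp) fun f g hf hg => by
      rw [map_add]; exact add_mem hf hg
  rw [wordSign_of_mem hf.2]
  exact Submodule.smul_mem _ _ hf.1

/-- The derivation of degree `-1` along `j` with given values on the generators, evaluated on a
word. -/
def derivWord (j : FreeGLA deg →ₗ[ℚ] N) (c : X → N) : FreeMagma X → N
  | FreeMagma.of x => c x
  | FreeMagma.mul a b => br (derivWord j c a) (j (FreeGLA.mk deg (word b)))
      + (-1 : ℚ) ^ wordDeg deg a • br (j (FreeGLA.mk deg (word a))) (derivWord j c b)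

section derivation

variable {j : FreeGLA deg →ₗ[ℚ] N} (hj : ∀ x y, j (br x y) = br (j x) (j y))
  (hj' : ∀ p, ∀ x ∈ comp p, j x ∈ comp p)

include hj' in
theorem derivWord_mem {c : X → N} (hc : ∀ x, c x ∈ comp (deg x - 1)) (w : FreeMagma X) :
    derivWord j c w ∈ comp (wordDeg deg w - 1) := by
  induction w using FreeMagma.rec with
  | of x => exact hc x
  | mul a b ha hb =>
    have ha' := hj' _ _ (FreeGLA.mk_mem_comp (word_mem deg a))
    have hb' := hj' _ _ (FreeGLA.mk_mem_comp (word_mem deg b))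
    have h1 : wordDeg deg a - 1 + wordDeg deg b = wordDeg deg (a * b) - 1 := by
      rw [wordDeg_mul]; ring
    have h2 : wordDeg deg a + (wordDeg deg b - 1) = wordDeg deg (a * b) - 1 := by
      rw [wordDeg_mul]; ring
    exact add_mem (h1 ▸ br_mem ha hb') (Submodule.smul_mem _ _ (h2 ▸ br_mem ha' hb))

/-- The sign operator absorbs the Koszul sign, giving a Leibniz rule that is bilinear and needs no
homogeneity. -/
theorem wordLin_derivWord_mul (c : X → N) (f g : Words X) :
    wordLin (derivWord j c) (f * g) = br (wordLin (derivWord j c) f) (j (FreeGLA.mk deg g))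
      + br (j (FreeGLA.mk deg (wordSign deg f))) (wordLin (derivWord j c) g) := by
  induction f using words_induction with
  | word u =>
    induction g using words_induction with
    | word w =>
      rw [word_mul_word, wordLin_word, wordLin_word, wordLin_word, wordSign, wordLin_word,
        map_smul, map_smul, map_smul, LinearMap.smul_apply]
      rfl
    | zero => simp
    | add g g' h h' =>
      simp only [mul_add, map_add, h, h']
      abel
    | smul c g h => simp only [mul_smul_comm, map_smul, h, smul_add]
  | zero => simp
  | add f f' h h' =>
    simp only [add_mul, map_add, h, h', LinearMap.add_apply]
    abel
  | smul c f h => simp only [smul_mul_assoc, map_smul, h, smul_add, LinearMap.smul_apply]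

include hj hj' in
-- The kernel of a derivation need not be an ideal, since the Leibniz rule also involves the
-- undifferentiated factor. Intersecting with `relIdeal` repairs this: that factor, or its image
-- under the sign operator, is then zero in the free Lie algebra.
theorem wordLin_derivWord_eq_zero {c : X → N} (hc : ∀ x, c x ∈ comp (deg x - 1)) :
    ∀ r ∈ relIdeal deg, wordLin (derivWord j c) r = 0 := by
  suffices h : relIdeal deg ≤ relIdeal deg ⊓ LinearMap.ker (wordLin (derivWord j c)) from
    fun r hr => (h hr).2
  refine sInf_le ⟨fun a b => ⟨relIdeal_antisymm deg a b, ?_⟩,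
    fun a b d => ⟨relIdeal_jacobi deg a b d, ?_⟩,
    fun f g hg => ⟨relIdeal_mul_left deg f g hg.1, ?_⟩,
    fun f hf g => ⟨relIdeal_mul_right deg f hf.1 g, ?_⟩⟩
  · change wordLin (derivWord j c) _ = 0
    simp only [map_add, map_smul, wordLin_derivWord_mul, wordLin_word,
      wordSign_of_mem (word_mem deg _), LinearMap.smul_apply]
    rw [br_antisymm (derivWord_mem hj' hc a) (hj' _ _ (FreeGLA.mk_mem_comp (word_mem deg b))),
      br_antisymm (derivWord_mem hj' hc b) (hj' _ _ (FreeGLA.mk_mem_comp (word_mem deg a)))]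
    rw [sub_mul, sub_mul, zpow_sub₀ (by norm_num), zpow_sub₀ (by norm_num)]
    rcases Int.even_or_odd (wordDeg deg a) with hp | hp <;>
      rcases Int.even_or_odd (wordDeg deg b) with hq | hq <;>
    simp [hp, hq, Even.neg_one_zpow, Odd.neg_one_zpow, Even.mul_left, Even.mul_right, Odd.mul,
      -MonoidAlgebra.smul_single]
  · change wordLin (derivWord j c) _ = 0
    simp only [map_add, map_smul, wordLin_derivWord_mul, wordLin_word,
      wordSign_of_mem (word_mem deg _), LinearMap.smul_apply, FreeGLA.mk_mul, hj]
    have ha := hj' _ _ (FreeGLA.mk_mem_comp (word_mem deg a))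
    have hb := hj' _ _ (FreeGLA.mk_mem_comp (word_mem deg b))
    have hd := hj' _ _ (FreeGLA.mk_mem_comp (word_mem deg d))
    have h1 := br_jacobi (derivWord_mem hj' hc a) hb hd
    have h2 := br_jacobi ha (derivWord_mem hj' hc b) hd
    have h3 := br_jacobi ha hb (derivWord_mem hj' hc d)
    generalize wordDeg deg a = p at *
    generalize wordDeg deg b = q at *
    generalize wordDeg deg d = r at *
    -- Differentiating the Jacobi expression gives three Jacobi identities, one for each
    -- differentiated argument. The weights are read off from the terms `[a, [b, d]]`: the Koszul
    -- sign of passing `D` to its argument, times the change of sign caused by lowering that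
    -- argument's degree by one.
    have h := congr((-1 : ℚ) ^ r • $h1 + (-1 : ℚ) ^ p • $h2 + (-1 : ℚ) ^ q • $h3)
    simp only [smul_zero, add_zero] at h
    rw [← h]
    simp only [sub_mul, mul_sub, one_mul, mul_one, zpow_sub₀ (show (-1 : ℚ) ≠ 0 by norm_num)]
    rcases Int.even_or_odd p with hp | hp <;> rcases Int.even_or_odd q with hq | hq <;>
      rcases Int.even_or_odd r with hr | hr <;>
    simp only [hp, hq, hr, Even.neg_one_zpow, Odd.neg_one_zpow, Even.mul_left, Even.mul_right,
      Odd.mul, one_smul, neg_smul, neg_neg] <;>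
    · simp
      abel
  · rw [SetLike.mem_coe, LinearMap.mem_ker, wordLin_derivWord_mul, LinearMap.mem_ker.1 hg.2,
      FreeGLA.mk_eq_zero.2 hg.1, map_zero, map_zero, map_zero, add_zero]
  · rw [SetLike.mem_coe, LinearMap.mem_ker, wordLin_derivWord_mul, LinearMap.mem_ker.1 hf.2,
      FreeGLA.mk_eq_zero.2 (wordSign_mem_relIdeal hf.1), map_zero, map_zero, map_zero, LinearMap.zero_apply,
      LinearMap.zero_apply, add_zero]

/-- The derivation of degree `-1` along `j` with given values on the generators. -/
def FreeGLA.deriv (c : X → N) (hc : ∀ x, c x ∈ comp (deg x - 1)) : FreeGLA deg →ₗ[ℚ] N :=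
  FreeGLA.liftLin (wordLin (derivWord j c)) (wordLin_derivWord_eq_zero hj hj' hc)

namespace FreeGLA

variable {c : X → N} (hc : ∀ x, c x ∈ comp (deg x - 1))

theorem deriv_gen (x : X) : deriv hj hj' c hc (gen deg x) = c x := by
  rw [deriv, ← mk_word_of, liftLin_mk, wordLin_word, derivWord]

theorem deriv_br {p : ℤ} {x : FreeGLA deg} (hx : x ∈ comp p) (y : FreeGLA deg) :
    deriv hj hj' c hc (br x y)
      = br (deriv hj hj' c hc x) (j y) + (-1 : ℚ) ^ p • br (j x) (deriv hj hj' c hc y) := by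
  obtain ⟨f, hf, rfl⟩ := exists_mk_eq_of_mem_comp hx
  obtain ⟨g, rfl⟩ := mk_surjective y
  rw [← mk_mul, deriv, liftLin_mk, liftLin_mk, liftLin_mk, wordLin_derivWord_mul,
    wordSign_of_mem hf, map_smul, map_smul, map_smul, LinearMap.smul_apply]

theorem deriv_mem {p : ℤ} {x : FreeGLA deg} (hx : x ∈ comp p) :
    deriv hj hj' c hc x ∈ comp (p - 1) := by
  obtain ⟨f, hf, rfl⟩ := exists_mk_eq_of_mem_comp hx
  rw [deriv, liftLin_mk]
  suffices h : wordComp deg p ≤ (comp (p - 1)).comap (wordLin (derivWord j c)) from h hf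
  refine Submodule.span_le.2 ?_
  rintro _ ⟨w, rfl, rfl⟩
  simpa using derivWord_mem hj' hc w

end FreeGLA

end derivation

end Free

/-! ## The complete free graded Lie algebra -/

section CompleteFree

variable {X : Type*} {deg : X → ℤ}

/-! ### Decomposition into brackets with generators. -/

namespace FreeGLA

/-- For a product of words, `[[a, b], y]` is a combination of `[a, [b, y]]` and `[b, [a, y]]`, whose
inner brackets lie one step deeper. Applying the induction there and then forgetting the gained step
explains why `n` and `y` are generalized. -/
theorem br_mem_iSup_br_gen {n : ℕ} (x y : FreeGLA deg) (hy : y ∈ lcs (FreeGLA deg) n) :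
    br x y ∈ ⨆ g, (lcs (FreeGLA deg) n).map (br (gen deg g)) := by
  have mono : ∀ n, (⨆ g, (lcs (FreeGLA deg) (n + 1)).map (br (gen deg g)))
      ≤ ⨆ g, (lcs (FreeGLA deg) n).map (br (gen deg g)) := fun n =>
    iSup_mono fun g => Submodule.map_mono (lcs_succ_le _ n)
  obtain ⟨f, rfl⟩ := mk_surjective x
  induction f using words_induction with
  | word w =>
    induction w using FreeMagma.rec generalizing n y with
    | of g => exact Submodule.mem_iSup_of_mem g ⟨y, hy, rfl⟩
    | mul a b ha hb =>
      have ha' := mk_mem_comp (word_mem deg a)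
      have hb' := mk_mem_comp (word_mem deg b)
      change br (mk deg (word (a * b))) y ∈ _
      rw [← word_mul_word, mk_mul, br_br ha' hb']
      exact sub_mem (mono n (ha _ (br_mem_lcs_succ _ _ _ hy)))
        (Submodule.smul_mem _ _ (mono n (hb _ (br_mem_lcs_succ _ _ _ hy))))
  | zero => simp
  | add f f' h h' => rw [map_add, map_add, LinearMap.add_apply]; exact add_mem h h'
  | smul c f h => rw [map_smul, map_smul, LinearMap.smul_apply]; exact Submodule.smul_mem _ _ h

/-- The cofactors are kept homogeneous because the limits in the completion are taken degree by
degree. -/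
theorem exists_br_gen_of_mem_lcs_succ [Fintype X] {n : ℕ} {p : ℤ} {z : FreeGLA deg}
    (hz : z ∈ lcs (FreeGLA deg) (n + 1)) (hp : z ∈ comp p) :
    ∃ y : X → FreeGLA deg, (∀ g, y g ∈ lcs (FreeGLA deg) n ⊓ comp (p - deg g)) ∧
      z = ∑ g, br (gen deg g) (y g) := by
  let K : ℤ → Submodule ℚ (FreeGLA deg) := fun q =>
    ⨆ g, (lcs (FreeGLA deg) n ⊓ comp (q - deg g)).map (br (gen deg g))
  have hK : ∀ q, K q ≤ comp q := fun q => by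
    refine iSup_le fun g => Submodule.map_le_iff_le_comap.2 fun y hy => ?_
    have h := br_mem (gen_mem_comp (deg := deg) g) hy.2
    rwa [add_sub_cancel] at h
  have hz' : z ∈ ⨆ q, K q := by
    suffices h : lcs (FreeGLA deg) (n + 1) ≤ ⨆ q, K q from h hz
    refine Submodule.span_le.2 ?_
    rintro _ ⟨x, y, hy, rfl⟩
    refine (iSup_le fun g => Submodule.map_le_iff_le_comap.2 fun y hy => ?_ :
      (⨆ g, (lcs (FreeGLA deg) n).map (br (gen deg g))) ≤ _) (br_mem_iSup_br_gen x y hy)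
    refine Submodule.iSup_induction _ (motive := fun y => br (gen deg g) y ∈ ⨆ q, K q)
      (lcs_homogeneous _ n hy) (fun q y hy => ?_) (by simp) fun y y' h h' => by
        rw [map_add]; exact add_mem h h'
    refine Submodule.mem_iSup_of_mem (q + deg g) (Submodule.mem_iSup_of_mem g ⟨y, ?_, rfl⟩)
    rwa [add_sub_cancel_right]
  have h := SignedGLA.exists_mem_of_iSupIndep comp_iSupIndep hK hp hz'
  obtain ⟨y, hy, hyz⟩ := (Submodule.mem_iSup_iff_exists_finsupp _ _).1 h
  choose u hu hu' using hy
  refine ⟨u, hu, ?_⟩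
  rw [← hyz, Finsupp.sum_fintype _ _ fun _ => rfl]
  exact Finset.sum_congr rfl fun g _ => (hu' g).symm

theorem mem_comp_le (p : ℤ) : comp (L := FreeGLA deg) p ≤
    Submodule.span ℚ {z | ∃ g, deg g = p ∧ z = gen deg g} ⊔ lcs (FreeGLA deg) 1 ⊓ comp p := by
  refine Submodule.map_le_iff_le_comap.2 (Submodule.span_le.2 ?_)
  rintro _ ⟨w, rfl, rfl⟩
  cases w with
  | of g => exact Submodule.mem_sup_left (Submodule.subset_span ⟨g, rfl, rfl⟩)
  | mul a b =>
    refine Submodule.mem_sup_right ⟨?_, mk_mem_comp (word_mem deg _)⟩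
    change mk deg (word (a * b)) ∈ _
    rw [← word_mul_word, mk_mul]
    exact br_mem_lcs_succ _ _ _ trivial

end FreeGLA

namespace Completion

open FreeGLA

/-- The differences of successive approximations of `z` decompose with cofactors ever deeper in the
lower central series. For each generator these cofactors have a fixed degree, so their sum converges
in the completion; finiteness of `X` makes the resulting expression for `z` a finite sum. -/
theorem exists_br_gen_of_mem_filt_one [Fintype X] {p : ℤ} {z : Completion (FreeGLA deg)}
    (hz : z ∈ filt (FreeGLA deg) 1) (hp : z ∈ comp p) :
    ∃ y : X → Completion (FreeGLA deg), z = ∑ g, br (of (gen deg g)) (y g) := by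
  have hs : ∃ s : ℕ → FreeGLA deg, s 0 = 0 ∧ ∀ n, s n ∈ comp p ∧
      (lcs (FreeGLA deg) (n + 1)).mkQ (s n) = proj _ (n + 1) z := by
    choose s hs hs' using fun n => exists_mem_comp_mkQ_eq_proj n hp
    -- The `n`-th approximation is exact at level `n + 1`. Starting from `0` is legitimate because
    -- `z` vanishes at level `1`, and makes the telescoping sum begin at zero.
    refine ⟨fun n => if n = 0 then 0 else s (n + 1), by simp, fun n => ?_⟩
    rcases eq_or_ne n 0 with rfl | hn
    · simpa using hz.symm
    · simpa [hn] using ⟨hs _, hs' _⟩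
  obtain ⟨s, hs0, hs⟩ := hs
  have hstep : ∀ n, s (n + 1) - s n ∈ lcs (FreeGLA deg) (n + 1) := fun n => by
    rw [← Submodule.Quotient.mk_eq_zero, Submodule.Quotient.mk_sub, sub_eq_zero]
    exact (proj_eq_mkQ (hs (n + 1)).2).trans (hs n).2.symm
  choose y hy hy' using fun n =>
    exists_br_gen_of_mem_lcs_succ (hstep n) (sub_mem (hs (n + 1)).1 (hs n).1)
  have hlim : ∀ g, (fun n => (lcs (FreeGLA deg) n).mkQ (∑ m ∈ Finset.range n, y m g))
      ∈ limComp (FreeGLA deg) (p - deg g) := fun g =>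
    ⟨fun n => ⟨_, sum_mem fun m _ => (hy m g).2, rfl⟩, fun n => by
      change (lcs (FreeGLA deg) n).mkQ (∑ m ∈ Finset.range (n + 1), y m g)
        = (lcs (FreeGLA deg) n).mkQ (∑ m ∈ Finset.range n, y m g)
      rw [Finset.sum_range_succ, map_add, add_eq_left]
      exact (Submodule.Quotient.mk_eq_zero _).2 (hy n g).1⟩
  refine ⟨fun g => .mk _ _ (Submodule.mem_iSup_of_mem _ (hlim g)), Completion.ext _ fun n => ?_⟩
  have h : ∀ g, proj _ n (br (of (gen deg g))
      (.mk _ _ (Submodule.mem_iSup_of_mem _ (hlim g)) : Completion (FreeGLA deg)))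
      = (lcs (FreeGLA deg) n).mkQ (br (gen deg g) (∑ m ∈ Finset.range n, y m g)) :=
    fun g => proj_br_mkQ rfl rfl
  rw [map_sum, Finset.sum_congr rfl fun g _ => h g, ← map_sum, ← proj_eq_mkQ (hs n).2]
  simp only [map_sum (br _)]
  rw [Finset.sum_comm, Finset.sum_congr rfl fun m _ => (hy' m).symm, Finset.sum_range_sub, hs0,
    sub_zero]

/-- An operator which vanishes on the generators and commutes with their adjoint actions up to
replacing these by other adjoint actions is zero. -/
theorem eq_zero_of_gen [Fintype X] (E : Completion (FreeGLA deg) →ₗ[ℚ] Completion (FreeGLA deg))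
    (β : X → Completion (FreeGLA deg)) (hgen : ∀ g, E (of (gen deg g)) = 0)
    (hbr : ∀ g z, E (br (of (gen deg g)) z) = br (β g) (E z)) : E = 0 := by
  -- No continuity of `E` is available. Up to a combination of generators, a homogeneous `z` is a
  -- finite sum of `[g, y_g]`, so linearity gives `E z = ∑ [β g, E (y_g)]`, one filtration step
  -- deeper than the values of `E`.
  have key : ∀ n z, E z ∈ filt _ n := fun n => by
    induction n with
    | zero => exact fun z => mem_filt_zero _
    | succ n ih =>
      refine fun z => SignedGLA.comp_induction z (fun p z hz => ?_) (by simp) fun z z' h h' => by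
        rw [map_add]; exact add_mem h h'
      obtain ⟨l, hl, hlz⟩ := exists_mem_comp_mkQ_eq_proj 1 hz
      obtain ⟨l₁, hl₁, l₂, hl₂, rfl⟩ := Submodule.mem_sup.1 (mem_comp_le p hl)
      have h1 : E (of l₁) = 0 := by
        suffices h : Submodule.span ℚ {z | ∃ g, deg g = p ∧ z = gen deg g}
            ≤ LinearMap.ker (E ∘ₗ ofLin _) from h hl₁
        refine Submodule.span_le.2 ?_
        rintro _ ⟨g, -, rfl⟩
        exact hgen g
      have h2 : l₁ ∈ comp p := by
        have := sub_mem hl hl₂.2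
        rwa [add_sub_cancel_right] at this
      have h3 : z - of l₁ ∈ filt _ 1 := by
        rw [mem_filt, map_sub, ← hlz, proj_of, ← map_sub, add_sub_cancel_left]
        exact (Submodule.Quotient.mk_eq_zero _).2 hl₂.1
      obtain ⟨y, hy⟩ := exists_br_gen_of_mem_filt_one h3 (sub_mem hz (of_mem_comp h2))
      rw [← sub_zero (E z), ← h1, ← map_sub, hy, map_sum]
      exact sum_mem fun g _ => by
        rw [hbr]
        exact br_mem_filt_succ _ (ih _)
  exact LinearMap.ext fun z => eq_zero_of_mem_filt fun n => key n z

/-! ### Continuous endomorphisms and derivations prescribed on the generators. -/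

section hom

variable {v : X → Completion (FreeGLA deg)} (hv : ∀ g, v g ∈ comp (deg g))

theorem lift_mem_filt {n : ℕ} {x : FreeGLA deg} (hx : x ∈ lcs _ n) : lift v hv x ∈ filt _ n := by
  induction n generalizing x with
  | zero => exact mem_filt_zero _
  | succ n ih =>
    suffices h : lcs _ (n + 1) ≤ (filt _ (n + 1)).comap (lift v hv) from h hx
    refine Submodule.span_le.2 ?_
    rintro _ ⟨x, y, hy, rfl⟩
    rw [SetLike.mem_coe, Submodule.mem_comap, lift_br]
    exact br_mem_filt_succ _ (ih hy)

/-- The continuous endomorphism of the complete free graded Lie algebra with given values on the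
generators. -/
def hom : Completion (FreeGLA deg) →ₗ[ℚ] Completion (FreeGLA deg) :=
  extend 0 (lift v hv) (fun _ _ hx => lift_mem_filt hv hx) fun p x hx => by
    rw [add_zero]; exact lift_mem hv hx

theorem hom_gen (g : X) : hom hv (of (gen deg g)) = v g := by rw [hom, extend_of, lift_gen]

theorem hom_br (u w : Completion (FreeGLA deg)) : hom hv (br u w) = br (hom hv u) (hom hv w) := by
  refine Completion.ext _ fun n => ?_
  obtain ⟨k, hk⟩ := exists_mkQ_eq_proj n u
  obtain ⟨l, hl⟩ := exists_mkQ_eq_proj n w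
  rw [hom, proj_extend (proj_br_mkQ hk hl).symm, lift_br, proj_br, proj_br, proj_extend hk,
    proj_extend hl]

theorem hom_mem {p : ℤ} {u : Completion (FreeGLA deg)} (hu : u ∈ comp p) : hom hv u ∈ comp p := by
  have h : hom hv u ∈ comp (p + 0) := extend_mem hu
  rwa [add_zero] at h

theorem hom_mem_filt (n : ℕ) (u : Completion (FreeGLA deg)) (hu : u ∈ filt _ n) :
    hom hv u ∈ filt _ n := extend_mem_filt hu

end hom

section der

variable {c : X → Completion (FreeGLA deg)} (hc : ∀ g, c g ∈ comp (deg g - 1))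

variable (c) in
/-- The derivation of degree `-1` from the free graded Lie algebra to its completion with given
values on the generators. -/
def derivOf : FreeGLA deg →ₗ[ℚ] Completion (FreeGLA deg) :=
  FreeGLA.deriv (j := ofLin (FreeGLA deg)) of_br (fun _ _ hx => of_mem_comp hx) c hc

theorem derivOf_br {p : ℤ} {x : FreeGLA deg} (hx : x ∈ comp p) (y : FreeGLA deg) :
    derivOf c hc (br x y) = br (derivOf c hc x) (of y) + (-1 : ℚ) ^ p • br (of x) (derivOf c hc y) :=
  deriv_br _ _ hc hx y

theorem derivOf_gen (g : X) : derivOf c hc (gen deg g) = c g := deriv_gen _ _ hc g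

theorem derivOf_mem (p : ℤ) (x : FreeGLA deg) (hx : x ∈ comp p) :
    derivOf c hc x ∈ comp (p + -1) := by
  rw [← sub_eq_add_neg]
  exact deriv_mem _ _ hc hx

theorem derivOf_mem_filt {n : ℕ} {x : FreeGLA deg} (hx : x ∈ lcs _ n) :
    derivOf c hc x ∈ filt _ n := by
  induction n generalizing x with
  | zero => exact mem_filt_zero _
  | succ n ih =>
    suffices h : lcs _ (n + 1) ≤ (filt _ (n + 1)).comap (derivOf c hc) from h hx
    refine Submodule.span_le.2 ?_
    rintro _ ⟨x, y, hy, rfl⟩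
    rw [SetLike.mem_coe, Submodule.mem_comap]
    refine SignedGLA.comp_induction x (fun p x hx => ?_) (by simp) fun x x' h h' => by
      rw [map_add, LinearMap.add_apply, map_add]; exact add_mem h h'
    rw [derivOf_br hc hx]
    exact add_mem (br_mem_filt_succ _ (of_mem_filt hy))
      (Submodule.smul_mem _ _ (br_mem_filt_succ _ (ih hy)))

/-- The continuous derivation of degree `-1` of the complete free graded Lie algebra with given
values on the generators. -/
def der : Completion (FreeGLA deg) →ₗ[ℚ] Completion (FreeGLA deg) :=
  extend (-1) (derivOf c hc) (fun _ _ hx => derivOf_mem_filt hc hx) (derivOf_mem hc)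

theorem der_gen (g : X) : der hc (of (gen deg g)) = c g := by
  rw [der, extend_of, derivOf_gen]

theorem der_br {p : ℤ} {u : Completion (FreeGLA deg)} (hu : u ∈ comp p)
    (w : Completion (FreeGLA deg)) :
    der hc (br u w) = br (der hc u) w + (-1 : ℚ) ^ p • br u (der hc w) := by
  refine Completion.ext _ fun n => ?_
  obtain ⟨k, hk', hk⟩ := exists_mem_comp_mkQ_eq_proj n hu
  obtain ⟨l, hl⟩ := exists_mkQ_eq_proj n w
  rw [der, proj_extend (proj_br_mkQ hk hl).symm, derivOf_br hc hk', map_add, map_add, map_smul,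
    map_smul, proj_br, proj_br, proj_br, proj_br, proj_extend hk, proj_extend hl, proj_of, proj_of,
    hk, hl]

theorem der_mem {p : ℤ} {u : Completion (FreeGLA deg)} (hu : u ∈ comp p) :
    der hc u ∈ comp (p - 1) := by
  rw [sub_eq_add_neg]
  exact extend_mem hu

theorem der_mem_filt (n : ℕ) (u : Completion (FreeGLA deg)) (hu : u ∈ filt _ n) :
    der hc u ∈ filt _ n := extend_mem_filt hu

end der

end Completion

end CompleteFree

/-! ## Identities between power series -/

/-- The power series `t / (e^t - 1)`. -/
def todd : PowerSeries ℚ := PowerSeries.mk toddCoeff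

theorem todd_mul_exp_sub_one : todd * (PowerSeries.exp ℚ - 1) = PowerSeries.X :=
  bernoulliPowerSeries_mul_exp_sub_one ℚ

theorem X_mul_expSubOneDiv :
    PowerSeries.X * Completion.expSubOneDiv = PowerSeries.exp ℚ - 1 := by
  ext n
  rcases n with _ | n
  · simp
  · rw [PowerSeries.coeff_succ_X_mul]
    simp [Completion.expSubOneDiv, PowerSeries.coeff_exp, PowerSeries.coeff_one]

theorem todd_mul_expSubOneDiv : todd * Completion.expSubOneDiv = 1 := by
  refine mul_left_cancel₀ (PowerSeries.X_ne_zero (R := ℚ)) ?_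
  rw [mul_left_comm, X_mul_expSubOneDiv, todd_mul_exp_sub_one, mul_one]

/-- Lets `b` be recovered from `∂'x`, and cancels the invertible operator in front of `∂'∂'x`. -/
theorem rescale_todd_mul_oneSubExpNegDiv :
    PowerSeries.rescale (-1) todd * Completion.oneSubExpNegDiv = 1 := by
  rw [Completion.oneSubExpNegDiv, ← map_mul, todd_mul_expSubOneDiv, map_one]

theorem exp_mul_rescale_exp :
    PowerSeries.exp ℚ * PowerSeries.rescale (-1) (PowerSeries.exp ℚ) = 1 :=
  PowerSeries.exp_mul_exp_neg_eq_one

theorem rescale_rescale_neg_one (f : PowerSeries ℚ) :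
    PowerSeries.rescale (-1) (PowerSeries.rescale (-1) f) = f := by
  rw [PowerSeries.rescale_rescale]
  simp

theorem expSubOneDiv_eq :
    Completion.expSubOneDiv = PowerSeries.exp ℚ * Completion.oneSubExpNegDiv := by
  refine mul_left_cancel₀ (PowerSeries.X_ne_zero (R := ℚ)) ?_
  have h := congrArg (PowerSeries.rescale (-1 : ℚ)) X_mul_expSubOneDiv
  rw [map_mul, map_sub, map_one, PowerSeries.rescale_X, ← Completion.oneSubExpNegDiv] at h
  simp only [map_neg, map_one, neg_mul, one_mul] at h
  rw [mul_left_comm, X_mul_expSubOneDiv, ← neg_neg (PowerSeries.X * Completion.oneSubExpNegDiv), h,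
    mul_neg, mul_sub, exp_mul_rescale_exp]
  ring

/-- Turns the correction term in `∂'(e^(ad_x) u)` into `[e^(ad_x) b, e^(ad_x) u]`. -/
theorem expSubOneDiv_mul_rescale_todd :
    Completion.expSubOneDiv * PowerSeries.rescale (-1) todd = PowerSeries.exp ℚ := by
  rw [expSubOneDiv_eq, mul_assoc, mul_comm Completion.oneSubExpNegDiv,
    rescale_todd_mul_oneSubExpNegDiv, mul_one]

/-- The summand `t` is the origin of the term `ad_x b` in the Lawrence–Sullivan formula. -/
theorem todd_mul_exp : todd * PowerSeries.exp ℚ = todd + PowerSeries.X := by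
  rw [← todd_mul_exp_sub_one]
  ring

/-! ## Uniqueness statements -/

theorem HasSeriesSum.unique {L : Type*} [AddCommGroup L] [Module ℚ L] [SignedGLA L]
    {s : ℕ → Completion L} {y z : Completion L} (hy : HasSeriesSum s y) (hz : HasSeriesSum s z) :
    y = z := Completion.ext L fun n => by
  obtain ⟨N, hN⟩ := hy n
  obtain ⟨N', hN'⟩ := hz n
  rw [← hN _ (le_max_left N N'), hN' _ (le_max_right N N')]

theorem Differential.ext_toFun {L : Type*} [AddCommGroup L] [Module ℚ L] [SignedGLA L]
    {d d' : Differential L} (h : d.toFun = d'.toFun) : d = d' := by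
  cases d; cases d'; simpa using h

theorem DGLIso.ext_toEquiv {L L' : Type*} [AddCommGroup L] [Module ℚ L] [SignedGLA L]
    [AddCommGroup L'] [Module ℚ L'] [SignedGLA L'] {d : Differential L} {d' : Differential L'}
    {φ ψ : DGLIso d d'} (h : ∀ x, φ.toEquiv x = ψ.toEquiv x) : φ = ψ := by
  have h' : φ.toEquiv = ψ.toEquiv := LinearEquiv.ext h
  cases φ; cases ψ; simpa using h'

instance : Fintype Gen := ⟨⟨[Gen.a, Gen.b, Gen.x], by simp⟩, by rintro (_ | _ | _) <;> simp⟩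

theorem of_gen_mem_comp (g : Gen) :
    Completion.of (FreeGLA.gen genDeg g) ∈ comp (L := LieABX) (genDeg g) :=
  Completion.of_mem_comp (FreeGLA.gen_mem_comp g)

theorem genA_mem : genA ∈ comp (L := LieABX) (-1) := of_gen_mem_comp Gen.a

theorem genB_mem : genB ∈ comp (L := LieABX) (-1) := of_gen_mem_comp Gen.b

theorem genX_mem : genX ∈ comp (L := LieABX) 0 := of_gen_mem_comp Gen.x

/-- The free choice of `β` covers derivations (signed generators), morphisms (images of the
generators) and the square of a derivation (the generators themselves). -/
theorem linearMap_eq_of_gen {f g : LieABX →ₗ[ℚ] LieABX} (β : Gen → LieABX)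
    (ha : f genA = g genA) (hb : f genB = g genB) (hx : f genX = g genX)
    (hbr : ∀ i z, (f - g) (br (Completion.of (FreeGLA.gen genDeg i)) z) = br (β i) ((f - g) z)) :
    f = g := by
  refine sub_eq_zero.1 (Completion.eq_zero_of_gen (f - g) β (fun i => ?_) hbr)
  cases i
  · exact sub_eq_zero.2 ha
  · exact sub_eq_zero.2 hb
  · exact sub_eq_zero.2 hx

/-- A differential on the complete free Lie algebra is determined by its values on `a`, `b`, `x`. -/
theorem Differential.eq_of_gen {d d' : Differential LieABX} (ha : d.toFun genA = d'.toFun genA)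
    (hb : d.toFun genB = d'.toFun genB) (hx : d.toFun genX = d'.toFun genX) : d = d' := by
  refine Differential.ext_toFun (linearMap_eq_of_gen
    (fun i => (-1 : ℚ) ^ genDeg i • Completion.of (FreeGLA.gen genDeg i)) ha hb hx fun i z => ?_)
  have h : d.toFun (Completion.of (FreeGLA.gen genDeg i))
      = d'.toFun (Completion.of (FreeGLA.gen genDeg i)) := by
    cases i
    · exact ha
    · exact hb
    · exact hx
  rw [LinearMap.sub_apply, LinearMap.sub_apply, d.leibniz z (of_gen_mem_comp i),
    d'.leibniz z (of_gen_mem_comp i), h, map_smul, LinearMap.smul_apply, map_sub, smul_sub]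
  abel

/-- A morphism out of the complete free Lie algebra is determined by its values on `a`, `b`, `x`. -/
theorem hom_eq_of_gen {f g : LieABX →ₗ[ℚ] LieABX} (hf : ∀ u v, f (br u v) = br (f u) (f v))
    (hg : ∀ u v, g (br u v) = br (g u) (g v))
    (ha : f genA = g genA) (hb : f genB = g genB) (hx : f genX = g genX) : f = g := by
  refine linearMap_eq_of_gen (fun i => f (Completion.of (FreeGLA.gen genDeg i))) ha hb hx
    fun i z => ?_
  have h : f (Completion.of (FreeGLA.gen genDeg i)) = g (Completion.of (FreeGLA.gen genDeg i)) := by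
    cases i
    · exact ha
    · exact hb
    · exact hx
  rw [LinearMap.sub_apply, LinearMap.sub_apply, hf, hg, h, map_sub]

/-! ## The modified differential -/

open Completion

/-- The value of the modified differential on the generators. -/
def modVal : Gen → LieABX
  | Gen.a => -((1 / 2 : ℚ) • br genA genA)
  | Gen.b => -((1 / 2 : ℚ) • br genB genB)
  | Gen.x => psEval genX_mem (PowerSeries.rescale (-1) todd) genB

theorem modVal_mem (g : Gen) : modVal g ∈ comp (genDeg g - 1) := by
  have hx : genDeg Gen.x - 1 = -1 := rfl
  cases g
  · exact neg_mem (Submodule.smul_mem _ _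
      ((show genDeg Gen.a - 1 = -1 + -1 from rfl) ▸ br_mem genA_mem genA_mem))
  · exact neg_mem (Submodule.smul_mem _ _
      ((show genDeg Gen.b - 1 = -1 + -1 from rfl) ▸ br_mem genB_mem genB_mem))
  · rw [hx]
    exact psEval_mem genX_mem _ genB_mem

/-- The derivation underlying the modified differential. -/
def modDer : LieABX →ₗ[ℚ] LieABX := der modVal_mem

theorem modDer_genA : modDer genA = -((1 / 2 : ℚ) • br genA genA) := der_gen modVal_mem Gen.a

theorem modDer_genB : modDer genB = -((1 / 2 : ℚ) • br genB genB) := der_gen modVal_mem Gen.b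

theorem modDer_genX : modDer genX = psEval genX_mem (PowerSeries.rescale (-1) todd) genB :=
  der_gen modVal_mem Gen.x

theorem modDer_br {p : ℤ} {u : LieABX} (hu : u ∈ comp p) (w : LieABX) :
    modDer (br u w) = br (modDer u) w + (-1 : ℚ) ^ p • br u (modDer w) := der_br modVal_mem hu w

theorem modDer_br_genX (u : LieABX) :
    modDer (br genX u) = br (modDer genX) u + br genX (modDer u) := by
  simpa using modDer_br genX_mem u

theorem modDer_mem_filt (n : ℕ) (u : LieABX) (hu : u ∈ filt (FreeGLA genDeg) n) :
    modDer u ∈ filt _ n := der_mem_filt modVal_mem n u hu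

theorem modDer_mem {p : ℤ} {u : LieABX} (hu : u ∈ comp p) : modDer u ∈ comp (p - 1) :=
  der_mem modVal_mem hu

/-- For `u` of odd degree the three Jacobi terms coincide, sign included, and `3` is invertible. -/
theorem br_self_br_self {L : Type*} [AddCommGroup L] [Module ℚ L] [SignedGLA L] {u : L}
    (hu : u ∈ comp (-1)) : br u (br u u) = 0 := by
  have h := br_jacobi hu hu hu
  norm_num at h
  have h' : (-3 : ℚ) • br u (br u u) = 0 := by rw [← h]; module
  simpa using h'

theorem modDer_modDer_eq_zero {u : LieABX} (hu : u ∈ comp (-1))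
    (h : modDer u = -((1 / 2 : ℚ) • br u u)) : modDer (modDer u) = 0 := by
  have h1 : br (br u u) u = 0 := by
    rw [br_antisymm (br_mem hu hu) hu, br_self_br_self hu]
    simp
  rw [h, map_neg, map_smul, modDer_br hu, h]
  simp [h1, br_self_br_self hu]

/-- With `c = b` in `derivation_psEval_oneSubExpNegDiv`, the quadratic term equals `∂'b`, so an
invertible series in `ad_x` kills `∂'∂'x`. -/
theorem modDer_modDer_genX : modDer (modDer genX) = 0 := by
  have hc : psEval genX_mem oneSubExpNegDiv (modDer genX) = genB := by
    rw [modDer_genX, ← psEval_mul, mul_comm, rescale_todd_mul_oneSubExpNegDiv, psEval_one]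
  have hx : modDer genX ∈ comp (-1) := by
    simpa only [zero_sub] using modDer_mem genX_mem
  have h := derivation_psEval_oneSubExpNegDiv genX_mem modDer_br_genX modDer_mem_filt hx
  rw [hc, modDer_genB, ← zero_sub, sub_left_inj] at h
  rw [← psEval_one genX_mem (modDer (modDer genX)), ← rescale_todd_mul_oneSubExpNegDiv,
    psEval_mul, ← h, map_zero]

/-- In the square of an odd derivation the mixed terms cancel, so it commutes with `ad_g` as soon as
it kills the generator `g`. -/
theorem modDer_modDer (u : LieABX) : modDer (modDer u) = 0 := by
  have h : modDer ∘ₗ modDer = 0 := by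
    refine linearMap_eq_of_gen (fun i => Completion.of (FreeGLA.gen genDeg i))
      (modDer_modDer_eq_zero genA_mem modDer_genA) (modDer_modDer_eq_zero genB_mem modDer_genB)
      modDer_modDer_genX fun i z => ?_
    have h0 : modDer (modDer (Completion.of (FreeGLA.gen genDeg i))) = 0 := by
      cases i
      · exact modDer_modDer_eq_zero genA_mem modDer_genA
      · exact modDer_modDer_eq_zero genB_mem modDer_genB
      · exact modDer_modDer_genX
    have hi := of_gen_mem_comp i
    simp only [sub_zero, LinearMap.comp_apply]
    rw [modDer_br hi, map_add, map_smul, modDer_br (modDer_mem hi), modDer_br hi, h0, map_zero,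
      LinearMap.zero_apply, zero_add, zpow_sub₀ (by norm_num)]
    rcases Int.even_or_odd (genDeg i) with hp | hp <;> simp [hp.neg_one_zpow]
  exact LinearMap.congr_fun h u

/-- The modified differential. -/
def modDifferential : Differential LieABX where
  toFun := modDer
  map_mem := modDer_mem
  leibniz := fun y hx => modDer_br hx y
  square_zero := modDer_modDer

theorem neg_genX_mem : -genX ∈ comp (L := LieABX) 0 := neg_mem genX_mem

theorem isModifiedDifferential_modDifferential : IsModifiedDifferential modDifferential := by
  refine ⟨modDer_genA, modDer_genB, ?_⟩
  have h := hasPowerSeriesValue_psEval neg_genX_mem (f := todd) (c := toddCoeff)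
    (fun i => PowerSeries.coeff_mk _ _) genB
  rw [psEval_neg genX_mem, map_neg] at h
  change HasPowerSeriesValue _ _ _ (modDer genX)
  rwa [modDer_genX]

theorem IsModifiedDifferential.unique {d d' : Differential LieABX}
    (hd : IsModifiedDifferential d) (hd' : IsModifiedDifferential d') : d = d' :=
  Differential.eq_of_gen (hd.1.trans hd'.1.symm) (hd.2.1.trans hd'.2.1.symm)
    (HasSeriesSum.unique hd.2.2 hd'.2.2)

theorem IsLSDifferential.unique {d d' : Differential LieABX}
    (hd : IsLSDifferential d) (hd' : IsLSDifferential d') : d = d' :=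
  Differential.eq_of_gen (add_right_cancel (hd.1.2.trans hd'.1.2.symm))
    (add_right_cancel (hd.2.1.2.trans hd'.2.1.2.symm))
    (sub_left_injective (HasSeriesSum.unique hd.2.2 hd'.2.2))

/-! ## The isomorphism -/

/-- The images of the generators under the isomorphism. -/
def isoVal : Gen → LieABX
  | Gen.a => genA
  | Gen.b => genA - psEval genX_mem (PowerSeries.exp ℚ) genB
  | Gen.x => -genX

theorem isoVal_mem (g : Gen) : isoVal g ∈ comp (genDeg g) := by
  cases g
  · exact genA_mem
  · exact sub_mem genA_mem (psEval_mem genX_mem _ genB_mem)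
  · exact neg_genX_mem

/-- The images of the generators under the inverse isomorphism. -/
def isoInvVal : Gen → LieABX
  | Gen.a => genA
  | Gen.b => psEval genX_mem (PowerSeries.exp ℚ) (genA - genB)
  | Gen.x => -genX

theorem isoInvVal_mem (g : Gen) : isoInvVal g ∈ comp (genDeg g) := by
  cases g
  · exact genA_mem
  · exact psEval_mem genX_mem _ (sub_mem genA_mem genB_mem)
  · exact neg_genX_mem

/-- The endomorphism `a ↦ a`, `b ↦ a - e^(ad_x) b`, `x ↦ -x`. -/
def isoFun : LieABX →ₗ[ℚ] LieABX := hom isoVal_mem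

/-- The endomorphism `a ↦ a`, `b ↦ e^(ad_x) (a - b)`, `x ↦ -x`. -/
def isoInvFun : LieABX →ₗ[ℚ] LieABX := hom isoInvVal_mem

theorem isoFun_genA : isoFun genA = genA := hom_gen isoVal_mem Gen.a

theorem isoFun_genB : isoFun genB = genA - psEval genX_mem (PowerSeries.exp ℚ) genB :=
  hom_gen isoVal_mem Gen.b

theorem isoFun_genX : isoFun genX = -genX := hom_gen isoVal_mem Gen.x

theorem isoFun_br (u v : LieABX) : isoFun (br u v) = br (isoFun u) (isoFun v) :=
  hom_br isoVal_mem u v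

theorem isoInvFun_genA : isoInvFun genA = genA := hom_gen isoInvVal_mem Gen.a

theorem isoInvFun_genB :
    isoInvFun genB = psEval genX_mem (PowerSeries.exp ℚ) (genA - genB) :=
  hom_gen isoInvVal_mem Gen.b

theorem isoInvFun_genX : isoInvFun genX = -genX := hom_gen isoInvVal_mem Gen.x

theorem isoInvFun_br (u v : LieABX) : isoInvFun (br u v) = br (isoInvFun u) (isoInvFun v) :=
  hom_br isoInvVal_mem u v

theorem hom_psEval_genX {v : Gen → LieABX} (hv : ∀ g, v g ∈ comp (genDeg g))
    (hx : v Gen.x = -genX) (f : PowerSeries ℚ) (u : LieABX) :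
    hom hv (psEval genX_mem f u) = psEval genX_mem (PowerSeries.rescale (-1) f) (hom hv u) := by
  have h : hom hv genX = -genX := (hom_gen hv Gen.x).trans hx
  rw [map_psEval genX_mem (hom_br hv) (hom_mem_filt hv) (hom_mem hv genX_mem),
    ← psEval_neg genX_mem f neg_genX_mem]
  congr! 2

theorem isoFun_isoInvFun (u : LieABX) : isoFun (isoInvFun u) = u := by
  have h : isoFun ∘ₗ isoInvFun = LinearMap.id := by
    refine hom_eq_of_gen (fun u v => ?_) (fun _ _ => rfl) ?_ ?_ ?_
    · simp [isoFun_br, isoInvFun_br]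
    · simp [isoFun_genA, isoInvFun_genA]
    · rw [LinearMap.comp_apply, isoInvFun_genB, isoFun, hom_psEval_genX _ rfl, ← isoFun, map_sub,
        isoFun_genA, isoFun_genB, sub_sub_cancel, ← psEval_mul, mul_comm, exp_mul_rescale_exp,
        psEval_one, LinearMap.id_apply]
    · simp [isoFun_genX, isoInvFun_genX]
  exact LinearMap.congr_fun h u

theorem isoInvFun_isoFun (u : LieABX) : isoInvFun (isoFun u) = u := by
  have h : isoInvFun ∘ₗ isoFun = LinearMap.id := by
    refine hom_eq_of_gen (fun u v => ?_) (fun _ _ => rfl) ?_ ?_ ?_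
    · simp [isoFun_br, isoInvFun_br]
    · simp [isoFun_genA, isoInvFun_genA]
    · rw [LinearMap.comp_apply, isoFun_genB, map_sub, isoInvFun_genA, isoInvFun,
        hom_psEval_genX _ rfl, ← isoInvFun, isoInvFun_genB, ← psEval_mul, mul_comm,
        exp_mul_rescale_exp, psEval_one, sub_sub_cancel, LinearMap.id_apply]
    · simp [isoFun_genX, isoInvFun_genX]
  exact LinearMap.congr_fun h u

/-- The differential of the Lawrence-Sullivan interval, transported from the modified differential
along the isomorphism. -/
def lsDifferential : Differential LieABX where
  toFun := isoFun ∘ₗ modDer ∘ₗ isoInvFun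
  map_mem := fun hx => hom_mem isoVal_mem (modDer_mem (hom_mem isoInvVal_mem hx))
  leibniz := fun {p x} y hx => by
    have hx' : isoInvFun x ∈ comp p := hom_mem isoInvVal_mem hx
    simp only [LinearMap.comp_apply]
    rw [isoInvFun_br, modDer_br hx', map_add,
      map_smul, isoFun_br, isoFun_br, isoFun_isoInvFun, isoFun_isoInvFun]
  square_zero := fun x => by
    simp only [LinearMap.comp_apply]
    rw [isoInvFun_isoFun, modDer_modDer, map_zero]

theorem lsDifferential_apply (u : LieABX) :
    lsDifferential.toFun u = isoFun (modDer (isoInvFun u)) := rfl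

/-- After factoring out `e^(ad_x)`, the claim is `∂'u + [b, u] = -½[u, u]` for `u = a - b`, which
follows by expanding with `[a, b] = [b, a]`. -/
theorem modDer_isoInvFun_genB :
    modDer (isoInvFun genB) = -((1 / 2 : ℚ) • br (isoInvFun genB) (isoInvFun genB)) := by
  have hab : br genA genB = br genB genA := by
    rw [br_antisymm genA_mem genB_mem]
    simp
  rw [isoInvFun_genB, derivation_psEval_exp genX_mem modDer_br_genX modDer_mem_filt, modDer_genX,
    ← psEval_mul, expSubOneDiv_mul_rescale_todd, ← psEval_exp_br, ← psEval_exp_br, ← map_smul,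
    ← map_neg, ← map_add]
  congr 1
  simp only [map_sub, LinearMap.sub_apply, modDer_genA, modDer_genB, hab]
  module

theorem isLSDifferential_lsDifferential : IsLSDifferential lsDifferential := by
  refine ⟨⟨genA_mem, ?_⟩, ⟨genB_mem, ?_⟩, ?_⟩
  · rw [lsDifferential_apply, isoInvFun_genA, modDer_genA, map_neg, map_smul, isoFun_br,
      isoFun_genA, neg_add_cancel]
  · rw [lsDifferential_apply, modDer_isoInvFun_genB, map_neg, map_smul, isoFun_br,
      isoFun_isoInvFun, neg_add_cancel]
  -- Transport replaces `x` by `-x`, so `∂x = -τ(ad_x)(a - e^(ad_x) b)` with `τ = t/(e^t - 1)`; then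
  -- `τ e^t = τ + t` separates the term `[x, b]`.
  · have h : lsDifferential.toFun genX - br genX genB = psEval genX_mem todd (genB - genA) := by
      rw [lsDifferential_apply, isoInvFun_genX, map_neg, map_neg, modDer_genX, isoFun,
        hom_psEval_genX _ rfl, ← isoFun, rescale_rescale_neg_one, isoFun_genB, map_sub, map_sub,
        ← psEval_mul, todd_mul_exp, psEval_add, psEval_X]
      abel
    rw [h]
    exact hasPowerSeriesValue_psEval genX_mem (fun i => PowerSeries.coeff_mk _ _) _

/-- The isomorphism between the modified differential and the Lawrence-Sullivan interval. -/
def lsIso : DGLIso modDifferential lsDifferential where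
  toEquiv := LinearEquiv.ofLinearMap isoFun isoInvFun (LinearMap.ext isoFun_isoInvFun)
    (LinearMap.ext isoInvFun_isoFun)
  map_mem := fun hx => hom_mem isoVal_mem hx
  map_br := isoFun_br
  map_d := fun x => by
    change isoFun (modDer x) = isoFun (modDer (isoInvFun (isoFun x)))
    rw [isoInvFun_isoFun]

theorem hasPowerSeriesValue_exp_genB : HasPowerSeriesValue expCoeff (br genX) genB
    (psEval genX_mem (PowerSeries.exp ℚ) genB) :=
  hasPowerSeriesValue_psEval genX_mem (fun i => by simp [expCoeff, PowerSeries.coeff_exp]) _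

end

end LSInterval

/-! ### Existence and uniqueness of the differentials and of the isomorphism. -/

open LSInterval LSInterval.SignedGLA in
theorem mainTheorem4 :
    (∃! d : LSInterval.Differential LSInterval.LieABX, LSInterval.IsLSDifferential d) ∧
    (∃! d' : LSInterval.Differential LSInterval.LieABX, LSInterval.IsModifiedDifferential d') ∧
    ∀ d d' : LSInterval.Differential LSInterval.LieABX,
      LSInterval.IsLSDifferential d → LSInterval.IsModifiedDifferential d' →
      ∃! φ : LSInterval.DGLIso d' d,
        φ.toEquiv LSInterval.genA = LSInterval.genA ∧
        LSInterval.HasPowerSeriesValue LSInterval.expCoeff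
          (LSInterval.SignedGLA.br LSInterval.genX) LSInterval.genB
          (LSInterval.genA - φ.toEquiv LSInterval.genB) ∧
        φ.toEquiv LSInterval.genX = -LSInterval.genX := by
  refine ⟨⟨lsDifferential, isLSDifferential_lsDifferential,
    fun d hd => hd.unique isLSDifferential_lsDifferential⟩,
    ⟨modDifferential, isModifiedDifferential_modDifferential,
    fun d hd => hd.unique isModifiedDifferential_modDifferential⟩, fun d d' hd hd' => ?_⟩
  -- Uniqueness allows arbitrary `d` and `d'` to be replaced by the constructed ones.
  obtain rfl := hd.unique isLSDifferential_lsDifferential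
  obtain rfl := hd'.unique isModifiedDifferential_modDifferential
  refine ⟨lsIso, ⟨isoFun_genA, ?_, isoFun_genX⟩, fun ψ ⟨ha, hb, hx⟩ => ?_⟩
  · change HasPowerSeriesValue _ _ _ (genA - isoFun genB)
    rw [isoFun_genB, sub_sub_cancel]
    exact hasPowerSeriesValue_exp_genB
  -- The condition on `b` says that a series sums to `a - ψ(b)`; uniqueness of sums then determines
  -- `ψ(b)`.
  · have hb' : ψ.toEquiv genB = isoFun genB := by
      rw [isoFun_genB, ← HasSeriesSum.unique hb hasPowerSeriesValue_exp_genB, sub_sub_cancel]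
    have h : ψ.toEquiv.toLinearMap = isoFun := hom_eq_of_gen ψ.map_br isoFun_br
      (ha.trans isoFun_genA.symm) hb' (hx.trans isoFun_genX.symm)
    exact DGLIso.ext_toEquiv (LinearMap.congr_fun h)
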